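/- **Corollary (Lower bound of accumulative interference).** Let $\Phi=\{x_i\}$ be a homogeneous Poisson point process on $\mathbb{R}^2$ with intensity $\lambda>0$, and let the channel gains $h_i$ be i.i.d. copies of a random variable $h$ with $h>0$ almost surely and $\bar h_{2/\alpha}:=E[h^{2/\alpha}]<\infty$, independent of $\Phi$, where $\alpha>2$. For a receiver at $x\in\mathbb{R}^2$ with reception angle $\phi\in(0,2\pi]$, let $z_1<z_2<\cdots$ be the ascending enumeration of the points $\|x_i-x\|^{\alpha}/h_i$ over all nodes $x_i$ such that the angle in $[0,2\pi)$ of the vector $x_i-x$ with respect to the horizontal axis is at most $\phi$, and let $\mathcal{I}(n)=\sum_{k=n+1}^{\infty}z_k^{-1}$. For $b>0$ and $a\in\mathbb{R}\setminus\{0,-1,-2,\dots\}$ let $\gamma(a,b)=\Gamma(a)-\int_b^\infty t^{a-1}e^{-t}\,dt$ be the (analytically continued) lower incomplete gamma function. Then for every integer $n\ge 1$ and every $s>0$ the series $\mathcal{I}(n)$ converges almost surely, $\gamma(-2/\alpha,s/z_n)$ is integrable, and the unconditional Laplace transform of $\mathcal{I}(n)$ satisfies $$E\left[e^{-s\,\mathcal{I}(n)}\right]\;\ge\;\exp\left\{n+\frac{\phi\lambda\,\bar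 h_{2/\alpha}\,s^{2/\alpha}}{\alpha}\,E_{z_n}\!\left[\gamma\!\left(-\tfrac{2}{\alpha},\tfrac{s}{z_n}\right)\right]\right\},$$ where $$E_{z_n}\!\left[\gamma\!\left(-\tfrac2\alpha,\tfrac s{z_n}\right)\right]=\int_0^\infty\gamma\!\left(-\tfrac2\alpha,\tfrac sz\right)f^{\phi}_{z_n}(z)\,dz,\qquad f^{\phi}_{z_n}(z)=\frac{2\,e^{-\frac12\bar h_{2/\alpha}\phi\lambda z^{2/\alpha}}\left(\frac12\bar h_{2/\alpha}\phi\lambda z^{2/\alpha}\right)^n}{\alpha z\,(n-1)!}.$$ -/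

import Mathlib

open MeasureTheory ProbabilityTheory Set
open scoped ENNReal

noncomputable section

/-- The plane `ℝ²` with the Euclidean norm and Lebesgue measure. -/
abbrev Plane : Type := EuclideanSpace ℝ (Fin 2)

/-- Number of indices `i` with `X i ω ∈ B`, i.e. the mass that the point configuration
`∑ i, δ_(X i ω)` gives to `B` (possibly infinite). -/
def pointCount {Ω E : Type*} (X : ℕ → Ω → E) (B : Set E) (ω : Ω) : ℕ∞ :=
  {i : ℕ | X i ω ∈ B}.encard

/-- The random points `X 0, X 1, …` enumerate a Poisson point process with intensity measure `Λ`: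
the number of points in a measurable set `B` of finite intensity is Poisson with mean `Λ B`, and
the numbers of points in pairwise disjoint measurable sets are independent. -/
structure IsPoissonProcess {Ω E : Type*} [MeasurableSpace Ω] [MeasurableSpace E]
    (P : Measure Ω) (X : ℕ → Ω → E) (Λ : Measure E) : Prop where
  measurable : ∀ i, Measurable (X i)
  poisson : ∀ B : Set E, MeasurableSet B → Λ B ≠ ∞ →
    HasLaw (pointCount X B) ((poissonMeasure (Λ B).toNNReal).map (Nat.cast : ℕ → ℕ∞)) P
  indep : ∀ (m : ℕ) (B : Fin m → Set E), (∀ j, MeasurableSet (B j)) →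
    Pairwise (fun i j => Disjoint (B i) (B j)) →
    iIndepFun (fun j => pointCount X (B j)) P

/-- Poisson network with intensity `lam` on the plane and i.i.d. channel gains of law `ν`:
`X i` is the position of node `i`, `h i` its channel gain, and the gains are independent of the
positions. -/
structure IsPoissonNetwork {Ω : Type*} [MeasurableSpace Ω] (P : Measure Ω)
    (lam : ℝ) (ν : Measure ℝ) (X : ℕ → Ω → Plane) (h : ℕ → Ω → ℝ) : Prop where
  nodes : IsPoissonProcess P X (ENNReal.ofReal lam • (volume : Measure Plane))
  gain_measurable : ∀ i, Measurable (h i)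
  gain_law : ∀ i, HasLaw (h i) ν P
  gain_indep : iIndepFun h P
  gains_indep_nodes : IndepFun (fun ω i => X i ω) (fun ω i => h i ω) P

/-- Angle in `[0, 2π)` of a vector of the plane, counted counterclockwise from the positive
horizontal axis. -/
def polarAngle (v : Plane) : ℝ :=
  if 0 ≤ Complex.arg ⟨v 0, v 1⟩ then Complex.arg ⟨v 0, v 1⟩
  else Complex.arg ⟨v 0, v 1⟩ + 2 * Real.pi

/-- Inverse received power `‖X i - x‖ ^ α / h i` of node `i` at the receiver `x`. -/
def invPower {Ω : Type*} (α : ℝ) (x : Plane) (X : ℕ → Ω → Plane) (h : ℕ → Ω → ℝ)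
    (i : ℕ) (ω : Ω) : ℝ :=
  ‖X i ω - x‖ ^ α / h i ω

/-- For `n ≥ 1`, the `n`-th smallest among the inverse received powers of the nodes that the
receiver at `x` sees within its reception angle `φ` (the smallest `t` such that at least `n` such
nodes have inverse power `≤ t`). Its inverse is the `n`-th dominant interference power. -/
def nthInvPower {Ω : Type*} (α φ : ℝ) (x : Plane) (X : ℕ → Ω → Plane) (h : ℕ → Ω → ℝ)
    (n : ℕ) (ω : Ω) : ℝ :=
  sInf {t : ℝ | (n : ℕ∞) ≤
    {i : ℕ | polarAngle (X i ω - x) ≤ φ ∧ invPower α x X h i ω ≤ t}.encard}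

/-- Partial accumulative interference `𝓘(n) = ∑_{k ≥ n + 1} z_k⁻¹`. -/
def partialInterference {Ω : Type*} (α φ : ℝ) (x : Plane) (X : ℕ → Ω → Plane) (h : ℕ → Ω → ℝ)
    (n : ℕ) (ω : Ω) : ℝ :=
  ∑' k : ℕ, (nthInvPower α φ x X h (n + 1 + k) ω)⁻¹

/-- Lower incomplete gamma function `γ(a, b)` for `b > 0` and real `a ∉ {0, -1, -2, …}`: the
analytic continuation in `a` of `∫₀ᵇ t ^ (a - 1) e ^ (-t) dt`, which converges only for `a > 0`,
written as `Γ(a) - Γ(a, b)` with the upper incomplete gamma function. -/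
def lowerGamma (a b : ℝ) : ℝ :=
  Real.Gamma a - ∫ t in Ioi b, t ^ (a - 1) * Real.exp (-t)

/-- For `a > 0` this is the usual integral. -/
theorem lowerGamma_of_pos {a b : ℝ} (ha : 0 < a) (hb : 0 ≤ b) :
    lowerGamma a b = ∫ t in Ioc 0 b, t ^ (a - 1) * Real.exp (-t) := by
  have hi : IntegrableOn (fun t : ℝ => t ^ (a - 1) * Real.exp (-t)) (Ioi 0) := by
    simpa only [mul_comm] using Real.GammaIntegral_convergent ha
  have hG : Real.Gamma a = ∫ t in Ioi 0, t ^ (a - 1) * Real.exp (-t) := by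
    rw [Real.Gamma_eq_integral ha]
    simp only [mul_comm]
  have hu : Ioc (0 : ℝ) b ∪ Ioi b = Ioi 0 := Ioc_union_Ioi_eq_Ioi hb
  have hs : (∫ t in Ioi (0 : ℝ), t ^ (a - 1) * Real.exp (-t)) =
      (∫ t in Ioc 0 b, t ^ (a - 1) * Real.exp (-t)) +
        ∫ t in Ioi b, t ^ (a - 1) * Real.exp (-t) := by
    rw [← hu]
    refine setIntegral_union ?_ measurableSet_Ioi ?_ ?_
    · exact Set.disjoint_left.2 fun t h1 h2 => not_lt.2 h1.2 h2
    · exact hi.mono_set Ioc_subset_Ioi_self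
    · exact hi.mono_set (Ioi_subset_Ioi hb)
  rw [lowerGamma, hG, hs]
  ring

/-- `E[h ^ (2 / α)]` for a channel gain `h` of law `ν`. -/
def gainMoment (α : ℝ) (ν : Measure ℝ) : ℝ :=
  ∫ t, t ^ (2 / α) ∂ν

/-- The probability density of the `n`-th smallest inverse power, at `z > 0`. -/
def invPowerPDF (lam α φ : ℝ) (ν : Measure ℝ) (n : ℕ) (z : ℝ) : ℝ :=
  2 * Real.exp (-(1 / 2 * gainMoment α ν * φ * lam * z ^ (2 / α))) *
    (1 / 2 * gainMoment α ν * φ * lam * z ^ (2 / α)) ^ n / (α * z * ((n - 1).factorial : ℝ))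

end

/-!
The inverse received powers of the visible nodes form a Poisson process on `(0, ∞)`: marking the
nodes with their gains, restricting to the visible ones and mapping by `(y, t) ↦ ‖y - x‖ ^ α / t`
preserves Poisson processes, which is read off their Laplace functionals. Its intensity gives mass
`c z ^ δ` to `(0, z]`, where `δ = 2 / α` and `c = ½ E[h ^ δ] φ λ`, so that `c z_n ^ δ` is
Gamma distributed with mean `n`.

Given `z_n = z`, the points beyond `z` are again Poisson, so the conditional Laplace transform of
the interference at `s` is `exp (-∫ y in (z, ∞), (1 - e ^ (-s / y)) cδ y ^ (δ - 1))`, which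
integration by parts turns into `exp (c z ^ δ + c δ s ^ δ γ(-δ, s / z))`. Averaging over `z_n` and
applying Jensen's inequality to the exponential yields the bound.
-/

open Filter Topology

section ExpNeg

/-- The function `a ↦ exp (-a)` on `[0, ∞]`, with `exp (-∞) = 0`; Laplace functionals of random
measures, whose integrals may be infinite, are expressed with it. -/
noncomputable def expNeg (a : ℝ≥0∞) : ℝ≥0∞ := EReal.exp (-(a : EReal))

lemma expNeg_zero : expNeg 0 = 1 := by simp [expNeg]

lemma expNeg_top : expNeg ∞ = 0 := by simp [expNeg]

lemma expNeg_ofReal {a : ℝ} (ha : 0 ≤ a) :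
    expNeg (ENNReal.ofReal a) = ENNReal.ofReal (Real.exp (-a)) := by
  rw [expNeg, EReal.coe_ennreal_ofReal, max_eq_left ha, ← EReal.coe_neg, EReal.exp_coe]

lemma expNeg_ne_zero {a : ℝ≥0∞} (ha : a ≠ ∞) : expNeg a ≠ 0 := by simp [expNeg, ha]

lemma continuous_expNeg : Continuous expNeg :=
  ENNReal.continuous_exp.comp (continuous_neg.comp continuous_coe_ennreal_ereal)

lemma measurable_expNeg : Measurable expNeg := continuous_expNeg.measurable

lemma antitone_expNeg : Antitone expNeg := fun _ _ h =>
  EReal.exp_monotone (EReal.neg_le_neg_iff.2 (EReal.coe_ennreal_le_coe_ennreal_iff.2 h))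

lemma expNeg_le_one (a : ℝ≥0∞) : expNeg a ≤ 1 :=
  expNeg_zero ▸ antitone_expNeg zero_le

lemma expNeg_ne_top (a : ℝ≥0∞) : expNeg a ≠ ∞ :=
  ((expNeg_le_one a).trans_lt ENNReal.one_lt_top).ne

lemma expNeg_add (a b : ℝ≥0∞) : expNeg (a + b) = expNeg a * expNeg b := by
  rw [expNeg, expNeg, expNeg, ← EReal.exp_add, EReal.coe_ennreal_add,
    EReal.neg_add (.inl (EReal.coe_ennreal_ne_bot a)) (.inr (EReal.coe_ennreal_ne_bot b)),
    sub_eq_add_neg]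

lemma expNeg_sum {ι : Type*} (s : Finset ι) (f : ι → ℝ≥0∞) :
    expNeg (∑ i ∈ s, f i) = ∏ i ∈ s, expNeg (f i) := by
  classical
  induction s using Finset.induction_on with
  | empty => simp [expNeg_zero]
  | insert a s ha ih => rw [Finset.sum_insert ha, Finset.prod_insert ha, expNeg_add, ih]

lemma expNeg_mul_natCast (a : ℝ≥0∞) (k : ℕ) : expNeg (a * k) = expNeg a ^ k := by
  induction k with
  | zero => simp [expNeg_zero]
  | succ k ih => rw [Nat.cast_succ, mul_add, mul_one, expNeg_add, ih, pow_succ]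

lemma expNeg_toENNReal_neg_log {q : ℝ≥0∞} (hq : q ≤ 1) :
    expNeg (-ENNReal.log q).toENNReal = q := by
  rw [expNeg, EReal.coe_toENNReal (EReal.neg_nonneg.2 (ENNReal.log_le_zero_iff.2 hq)), neg_neg,
    ENNReal.exp_log]

lemma one_sub_expNeg_le (a : ℝ≥0∞) : 1 - expNeg a ≤ a := by
  induction a with
  | top => exact le_top
  | coe a =>
    rw [← ENNReal.ofReal_coe_nnreal, expNeg_ofReal a.coe_nonneg, ← ENNReal.ofReal_one,
      ← ENNReal.ofReal_sub _ (Real.exp_pos _).le]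
    exact ENNReal.ofReal_le_ofReal (by linarith [Real.add_one_le_exp (-(a : ℝ))])

lemma tendsto_lintegral_expNeg {Ω : Type*} [MeasurableSpace Ω] {P : Measure Ω} [IsFiniteMeasure P]
    {f : ℕ → Ω → ℝ≥0∞} {g : Ω → ℝ≥0∞} (hf : ∀ k, Measurable (f k))
    (hlim : ∀ ω, Tendsto (fun k => f k ω) atTop (𝓝 (g ω))) :
    Tendsto (fun k => ∫⁻ ω, expNeg (f k ω) ∂P) atTop (𝓝 (∫⁻ ω, expNeg (g ω) ∂P)) :=
  tendsto_lintegral_of_dominated_convergence (fun _ => 1)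
    (fun k => measurable_expNeg.comp (hf k)) (fun _ => .of_forall fun _ => expNeg_le_one _)
    (by simp) (.of_forall fun ω => (continuous_expNeg.tendsto _).comp (hlim ω))

end ExpNeg

section PoissonWeight

/-- The probability that a Poisson variable of mean `m` equals `k`, as a function of a real `m` so
that it can be differentiated. -/
noncomputable def poissonWeight (m : ℝ) (k : ℕ) : ℝ := Real.exp (-m) * m ^ k / k.factorial

lemma poissonWeight_nonneg {m : ℝ} (hm : 0 ≤ m) (k : ℕ) : 0 ≤ poissonWeight m k := by
  unfold poissonWeight; positivity

lemma hasSum_poissonWeight_mul_pow (m x : ℝ) :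
    HasSum (fun k => poissonWeight m k * x ^ k) (Real.exp (-(m * (1 - x)))) := by
  have hexp : HasSum (fun k : ℕ => (m * x) ^ k / k.factorial) (Real.exp (m * x)) := by
    rw [Real.exp_eq_exp_ℝ]
    exact NormedSpace.expSeries_div_hasSum_exp (m * x)
  convert! hexp.mul_left (Real.exp (-m)) using 1
  · funext k
    rw [poissonWeight, mul_pow]
    ring
  · rw [← Real.exp_add]
    ring_nf

lemma tsum_ofReal_poissonWeight_mul_pow {m : ℝ} (hm : 0 ≤ m) {q : ℝ≥0∞} (hq : q ≤ 1) :
    ∑' k, ENNReal.ofReal (poissonWeight m k) * q ^ k = expNeg (ENNReal.ofReal m * (1 - q)) := by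
  lift q to NNReal using ne_top_of_le_ne_top ENNReal.one_ne_top hq
  have hq1 : (q : ℝ) ≤ 1 := by exact_mod_cast hq
  have hsum := hasSum_poissonWeight_mul_pow m q
  have hterm (k : ℕ) : ENNReal.ofReal (poissonWeight m k) * (q : ℝ≥0∞) ^ k =
      ENNReal.ofReal (poissonWeight m k * (q : ℝ) ^ k) := by
    rw [ENNReal.ofReal_mul (poissonWeight_nonneg hm k), ENNReal.ofReal_pow q.coe_nonneg,
      ENNReal.ofReal_coe_nnreal]
  simp_rw [hterm]
  rw [← ENNReal.ofReal_tsum_of_nonneg (fun k => mul_nonneg (poissonWeight_nonneg hm k)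
    (pow_nonneg q.coe_nonneg k)) hsum.summable, hsum.tsum_eq, ← expNeg_ofReal
    (mul_nonneg hm (sub_nonneg.2 hq1)), ENNReal.ofReal_mul hm, ENNReal.ofReal_sub _ q.coe_nonneg,
    ENNReal.ofReal_one, ENNReal.ofReal_coe_nnreal]

lemma lintegral_expNeg_poissonMeasure (m : NNReal) (r : ℝ≥0∞) :
    ∫⁻ k, expNeg (r * (k : ℝ≥0∞)) ∂(poissonMeasure m) = expNeg (m * (1 - expNeg r)) := by
  rw [lintegral_countable', ← ENNReal.ofReal_coe_nnreal,
    ← tsum_ofReal_poissonWeight_mul_pow m.coe_nonneg (expNeg_le_one r)]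
  refine tsum_congr fun k => ?_
  rw [expNeg_mul_natCast, poissonMeasure_singleton, mul_comm, poissonWeight]

end PoissonWeight

section PowerSeries

lemma one_le_radius_ofScalars {a : ℕ → ℝ} (ha : Summable a) :
    1 ≤ (FormalMultilinearSeries.ofScalars ℝ a).radius := by
  refine FormalMultilinearSeries.le_radius_of_summable (r := 1) _ ?_
  simpa [FormalMultilinearSeries.ofScalars_norm] using ha.abs

lemma hasFPowerSeriesAt_tsum_mul_pow {a : ℕ → ℝ} (ha : Summable a) :
    HasFPowerSeriesAt (fun x => ∑' k, a k * x ^ k) (.ofScalars ℝ a) 0 := by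
  have hsum : HasFPowerSeriesAt (FormalMultilinearSeries.ofScalarsSum a) (.ofScalars ℝ a) 0 :=
    (FormalMultilinearSeries.hasFPowerSeriesOnBall _
      (zero_lt_one.trans_le (one_le_radius_ofScalars ha))).hasFPowerSeriesAt
  simpa only [FormalMultilinearSeries.ofScalarsSum_eq_tsum, smul_eq_mul] using hsum

lemma eq_of_tsum_mul_pow_eq {a b : ℕ → ℝ} (ha : Summable a) (hb : Summable b)
    (hab : ∀ x ∈ Ioo (0 : ℝ) 1, ∑' k, a k * x ^ k = ∑' k, b k * x ^ k) : a = b := by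
  have ha' := hasFPowerSeriesAt_tsum_mul_pow ha
  have hb' := hasFPowerSeriesAt_tsum_mul_pow hb
  have hfreq : ∃ᶠ x in 𝓝[≠] (0 : ℝ), ∑' k, a k * x ^ k = ∑' k, b k * x ^ k :=
    (eventually_of_mem (Ioo_mem_nhdsGT one_pos) hab).frequently.filter_mono
      (nhdsWithin_mono 0 fun _ hx => ne_of_gt hx)
  exact FormalMultilinearSeries.ofScalars_series_injective ℝ ℝ
    (ha'.eq_formalMultilinearSeries_of_eventually hb'
      ((ha'.analyticAt.frequently_eq_iff_eventually_eq hb'.analyticAt).1 hfreq))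

lemma eq_of_tsum_mul_pow_eq_of_ne_top {a b : ℕ → ℝ≥0∞} (ha : ∑' k, a k ≠ ∞) (hb : ∑' k, b k ≠ ∞)
    (hab : ∀ q, 0 < q → q < 1 → ∑' k, a k * q ^ k = ∑' k, b k * q ^ k) : a = b := by
  have toReal_tsum {d : ℕ → ℝ≥0∞} (hd : ∑' k, d k ≠ ∞) {x : ℝ} (hx : 0 ≤ x) :
      (∑' k, d k * ENNReal.ofReal x ^ k).toReal = ∑' k, (d k).toReal * x ^ k := by
    rw [ENNReal.tsum_toReal_eq fun k => ENNReal.mul_ne_top (ENNReal.ne_top_of_tsum_ne_top hd k)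
      (ENNReal.pow_ne_top ENNReal.ofReal_ne_top)]
    simp_rw [ENNReal.toReal_mul, ENNReal.toReal_pow, ENNReal.toReal_ofReal hx]
  have htoReal := eq_of_tsum_mul_pow_eq (ENNReal.summable_toReal ha) (ENNReal.summable_toReal hb)
    fun x hx => by
      rw [← toReal_tsum ha hx.1.le, ← toReal_tsum hb hx.1.le,
        hab _ (ENNReal.ofReal_pos.2 hx.1) (by simpa using hx.2)]
  funext k
  exact (ENNReal.toReal_eq_toReal_iff' (ENNReal.ne_top_of_tsum_ne_top ha k)
    (ENNReal.ne_top_of_tsum_ne_top hb k)).1 (congrFun htoReal k)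

end PowerSeries

lemma tsum_iSup_of_monotone {ι : Type*} {f : ℕ → ι → ℝ≥0∞} (hf : Monotone f) :
    ∑' i, ⨆ k, f k i = ⨆ k, ∑' i, f k i := by
  let _ : MeasurableSpace ι := ⊤
  simp_rw [← lintegral_count]
  exact lintegral_iSup (fun _ => .of_discrete) hf

lemma tsum_indicator_const_comp {Ω E : Type*} (X : ℕ → Ω → E) (B : Set E) (ω : Ω) (r : ℝ≥0∞) :
    ∑' i, B.indicator (fun _ => r) (X i ω) = r * (pointCount X B ω : ℝ≥0∞) := by
  rw [pointCount, mul_comm, ← ENNReal.tsum_set_const, tsum_subtype _ (fun _ => r)]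
  rfl

section PoissonProcess

lemma exists_monotone_finMeasSupp_iSup_eq {E : Type*} [MeasurableSpace E] (Λ : Measure E)
    [SigmaFinite Λ] {v : E → ℝ≥0∞} (hv : Measurable v) :
    ∃ u : ℕ → SimpleFunc E ℝ≥0∞,
      Monotone u ∧ (∀ k, (u k).FinMeasSupp Λ) ∧ ∀ y, ⨆ k, u k y = v y := by
  let u (k : ℕ) : SimpleFunc E ℝ≥0∞ := (SimpleFunc.eapprox v k).restrict (spanningSets Λ k)
  have hu (k : ℕ) (y : E) : u k y = (spanningSets Λ k).indicator (SimpleFunc.eapprox v k) y :=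
    SimpleFunc.restrict_apply _ (measurableSet_spanningSets Λ k) y
  have hmono : Monotone u := fun k l hkl y => by
    rw [hu, hu]
    exact (indicator_le_indicator_of_subset (monotone_spanningSets Λ hkl) (fun _ => zero_le)
      y).trans (indicator_le_indicator (SimpleFunc.monotone_eapprox v hkl y))
  refine ⟨u, hmono, fun k => SimpleFunc.finMeasSupp_iff_support.2 ?_, fun y => ?_⟩
  · refine (measure_mono fun y hy => ?_).trans_lt (measure_spanningSets_lt_top Λ k)
    rw [Function.mem_support, hu] at hy
    exact mem_of_indicator_ne_zero hy
  · refine iSup_eq_of_tendsto (fun k l hkl => hmono hkl y)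
      ((SimpleFunc.tendsto_eapprox hv y).congr' ?_)
    filter_upwards [eventually_mem_spanningSets Λ y] with k hk
    rw [hu, indicator_of_mem hk]

lemma tsum_simpleFunc_comp_eq_sum_mul_pointCount {Ω E : Type*} [MeasurableSpace E]
    (X : ℕ → Ω → E) (v : SimpleFunc E ℝ≥0∞) (ω : Ω) :
    ∑' i, v (X i ω) = ∑ r ∈ v.range, r * (pointCount X (v ⁻¹' {r}) ω : ℝ≥0∞) := by
  classical
  simp_rw [← tsum_indicator_const_comp]
  rw [← Summable.tsum_finsetSum (fun _ _ => ENNReal.summable)]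
  refine tsum_congr fun i => ?_
  rw [Finset.sum_eq_single_of_mem (v (X i ω)) (v.mem_range_self _),
    indicator_of_mem (show X i ω ∈ v ⁻¹' {v (X i ω)} from rfl)]
  exact fun r _ hr => indicator_of_notMem (s := v ⁻¹' {r}) (fun h => hr (Eq.symm h)) _

variable {Ω E : Type*} [MeasurableSpace Ω] [MeasurableSpace E] {P : Measure Ω}
  {X : ℕ → Ω → E} {Λ : Measure E}

lemma IsPoissonProcess.isProbabilityMeasure (hX : IsPoissonProcess P X Λ) :
    IsProbabilityMeasure P :=
  (hX.indep 0 (fun _ => ∅) (fun i => i.elim0) (fun i => i.elim0)).isProbabilityMeasure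

lemma IsPoissonProcess.measurable_pointCount (hX : IsPoissonProcess P X Λ) {B : Set E}
    (hB : MeasurableSet B) : Measurable fun ω => (pointCount X B ω : ℝ≥0∞) := by
  have hcount (ω : Ω) : (pointCount X B ω : ℝ≥0∞) = ∑' i, B.indicator (fun _ => 1) (X i ω) := by
    rw [tsum_indicator_const_comp X, one_mul]
  simp_rw [hcount]
  exact Measurable.tsum fun i => (measurable_const.indicator hB).comp (hX.measurable i)

lemma IsPoissonProcess.lintegral_expNeg_pointCount (hX : IsPoissonProcess P X Λ) {B : Set E}
    (hB : MeasurableSet B) (hΛ : Λ B ≠ ∞) (r : ℝ≥0∞) :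
    ∫⁻ ω, expNeg (r * (pointCount X B ω : ℝ≥0∞)) ∂P = expNeg (Λ B * (1 - expNeg r)) := by
  have hm : Measurable fun k : ℕ∞ => expNeg (r * (k : ℝ≥0∞)) :=
    measurable_expNeg.comp .of_discrete
  rw [(hX.poisson B hB hΛ).lintegral_comp hm.aemeasurable, lintegral_map hm .of_discrete]
  simp only [ENat.toENNReal_coe]
  rw [lintegral_expNeg_poissonMeasure, ENNReal.coe_toNNReal hΛ]

lemma IsPoissonProcess.iIndepFun_pointCount_preimage (hX : IsPoissonProcess P X Λ)
    (v : SimpleFunc E ℝ≥0∞) :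
    iIndepFun (fun (r : v.range) ω => pointCount X (v ⁻¹' {r.1}) ω) P := by
  have e := v.range.equivFin
  have hfin := hX.indep v.range.card (fun j => v ⁻¹' {(e.symm j).1})
    (fun j => v.measurableSet_preimage _) fun i j hij => Disjoint.preimage _ <|
      disjoint_singleton.2 fun h => hij (e.symm.injective (Subtype.ext h))
  simpa using hfin.precomp e.injective

lemma IsPoissonProcess.lintegral_expNeg_tsum_simpleFunc (hX : IsPoissonProcess P X Λ)
    {v : SimpleFunc E ℝ≥0∞} (hv : v.FinMeasSupp Λ) :
    ∫⁻ ω, expNeg (∑' i, v (X i ω)) ∂P = expNeg (∫⁻ y, (1 - expNeg (v y)) ∂Λ) := by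
  have := hX.isProbabilityMeasure
  have hfactor (r : ℝ≥0∞) : ∫⁻ ω, expNeg (r * (pointCount X (v ⁻¹' {r}) ω : ℝ≥0∞)) ∂P =
      expNeg ((1 - expNeg r) * Λ (v ⁻¹' {r})) := by
    rcases eq_or_ne r 0 with rfl | hr
    · simp [expNeg_zero]
    · rw [hX.lintegral_expNeg_pointCount (v.measurableSet_preimage _)
        (hv.meas_preimage_singleton_ne_zero hr).ne, mul_comm]
  have hindep := (hX.iIndepFun_pointCount_preimage v).comp
    (fun r k => expNeg (r.1 * (k : ℝ≥0∞))) fun r => measurable_expNeg.comp .of_discrete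
  calc ∫⁻ ω, expNeg (∑' i, v (X i ω)) ∂P
      = ∫⁻ ω, ∏ r : v.range, expNeg (r.1 * (pointCount X (v ⁻¹' {r.1}) ω : ℝ≥0∞)) ∂P := by
        refine lintegral_congr fun ω => ?_
        rw [tsum_simpleFunc_comp_eq_sum_mul_pointCount, expNeg_sum, Finset.prod_coe_sort v.range
          fun r => expNeg (r * (pointCount X (v ⁻¹' {r}) ω : ℝ≥0∞))]
    _ = ∏ r : v.range, ∫⁻ ω, expNeg (r.1 * (pointCount X (v ⁻¹' {r.1}) ω : ℝ≥0∞)) ∂P :=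
        lintegral_prod_eq_prod_lintegral_of_indepFun _ _ hindep fun r => measurable_expNeg.comp
          ((hX.measurable_pointCount (v.measurableSet_preimage _)).const_mul _)
    _ = expNeg (∑ r ∈ v.range, (1 - expNeg r) * Λ (v ⁻¹' {r})) := by
        simp_rw [hfactor]
        rw [expNeg_sum, Finset.prod_coe_sort v.range
          fun r => expNeg ((1 - expNeg r) * Λ (v ⁻¹' {r}))]
    _ = expNeg (∫⁻ y, (1 - expNeg (v y)) ∂Λ) := by
        rw [← SimpleFunc.map_lintegral (fun r => 1 - expNeg r) v,
          ← SimpleFunc.lintegral_eq_lintegral]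
        rfl

theorem IsPoissonProcess.lintegral_expNeg_tsum [SigmaFinite Λ] (hX : IsPoissonProcess P X Λ)
    {v : E → ℝ≥0∞} (hv : Measurable v) :
    ∫⁻ ω, expNeg (∑' i, v (X i ω)) ∂P = expNeg (∫⁻ y, (1 - expNeg (v y)) ∂Λ) := by
  have := hX.isProbabilityMeasure
  obtain ⟨u, hmono, hsupp, hsup⟩ := exists_monotone_finMeasSupp_iSup_eq Λ hv
  have hlim (y : E) : Tendsto (fun k => u k y) atTop (𝓝 (v y)) :=
    hsup y ▸ tendsto_atTop_iSup fun k l hkl => hmono hkl y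
  have hsum : Tendsto (fun k => ∫⁻ ω, expNeg (∑' i, u k (X i ω)) ∂P) atTop
      (𝓝 (∫⁻ ω, expNeg (∑' i, v (X i ω)) ∂P)) := by
    refine tendsto_lintegral_expNeg
      (fun k => Measurable.tsum fun i => (u k).measurable.comp (hX.measurable i)) fun ω => ?_
    have hmonoω : Monotone fun k i => u k (X i ω) := fun k l hkl i => hmono hkl _
    simp_rw [← hsup, tsum_iSup_of_monotone hmonoω]
    exact tendsto_atTop_iSup fun k l hkl => ENNReal.tsum_le_tsum (hmonoω hkl)
  have hint : Tendsto (fun k => expNeg (∫⁻ y, (1 - expNeg (u k y)) ∂Λ)) atTop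
      (𝓝 (expNeg (∫⁻ y, (1 - expNeg (v y)) ∂Λ))) := by
    refine (continuous_expNeg.tendsto _).comp (lintegral_tendsto_of_tendsto_of_monotone
      (fun k => (measurable_const.sub (measurable_expNeg.comp (u k).measurable)).aemeasurable)
      (.of_forall fun y k l hkl => tsub_le_tsub_left (antitone_expNeg (hmono hkl y)) 1)
      (.of_forall fun y => ?_))
    exact ENNReal.Tendsto.sub tendsto_const_nhds ((continuous_expNeg.tendsto _).comp (hlim y))
      (.inl ENNReal.one_ne_top)
  simp_rw [hX.lintegral_expNeg_tsum_simpleFunc (hsupp _)] at hsum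
  exact tendsto_nhds_unique hsum hint

end PoissonProcess

section Marking

variable {Ω E F : Type*} [MeasurableSpace Ω] [MeasurableSpace E] [MeasurableSpace F]
  {P : Measure Ω} {X : ℕ → Ω → E} {h : ℕ → Ω → F} {ν : Measure F}

lemma lintegral_prod_comp_eq_prod_lintegral {ι : Type*} {h : ι → Ω → F}
    (hm : ∀ i, Measurable (h i)) (hlaw : ∀ i, HasLaw (h i) ν P) (hi : iIndepFun h P)
    (s : Finset ι) {g : ι → F → ℝ≥0∞} (hg : ∀ i, Measurable (g i)) :
    ∫⁻ ω, ∏ i ∈ s, g i (h i ω) ∂P = ∏ i ∈ s, ∫⁻ t, g i t ∂ν :=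
  (lintegral_prod_eq_prod_lintegral_of_indepFun s (fun i ω => g i (h i ω)) (hi.comp g hg)
    fun i => (hg i).comp (hm i)).trans
    (Finset.prod_congr rfl fun i _ => (hlaw i).lintegral_comp (hg i).aemeasurable)

lemma lintegral_expNeg_sum_marks (hX : ∀ i, Measurable (X i)) (hm : ∀ i, Measurable (h i))
    (hlaw : ∀ i, HasLaw (h i) ν P) (hi : iIndepFun h P)
    (hXh : IndepFun (fun ω i => X i ω) (fun ω i => h i ω) P)
    {v : E × F → ℝ≥0∞} (hv : Measurable v) (s : Finset ℕ) :
    ∫⁻ ω, expNeg (∑ i ∈ s, v (X i ω, h i ω)) ∂P =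
      ∫⁻ ω, ∏ i ∈ s, ∫⁻ t, expNeg (v (X i ω, t)) ∂ν ∂P := by
  have := hi.isProbabilityMeasure
  have : IsProbabilityMeasure ν := (hlaw 0).isProbabilityMeasure_iff.1 inferInstance
  have hXm : Measurable fun ω i => X i ω := measurable_pi_lambda _ hX
  have hhm : Measurable fun ω i => h i ω := measurable_pi_lambda _ hm
  have hev : Measurable fun p => expNeg (v p) := measurable_expNeg.comp hv
  let Φ (p : (ℕ → E) × (ℕ → F)) : ℝ≥0∞ := ∏ i ∈ s, expNeg (v (p.1 i, p.2 i))
  have hΦ : Measurable Φ := Finset.measurable_prod _ fun i _ => hev.comp (by fun_prop)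
  have := Measure.isProbabilityMeasure_map (μ := P) hhm.aemeasurable
  calc ∫⁻ ω, expNeg (∑ i ∈ s, v (X i ω, h i ω)) ∂P
      = ∫⁻ p, Φ p ∂(P.map fun ω => (fun i => X i ω, fun i => h i ω)) := by
        rw [lintegral_map hΦ (hXm.prodMk hhm)]
        simp_rw [expNeg_sum]
        rfl
    _ = ∫⁻ x, ∫⁻ t, Φ (x, t) ∂(P.map fun ω i => h i ω) ∂(P.map fun ω i => X i ω) := by
        rw [(indepFun_iff_map_prod_eq_prod_map_map hXm.aemeasurable hhm.aemeasurable).1 hXh,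
          lintegral_prod _ hΦ.aemeasurable]
    _ = ∫⁻ x, ∏ i ∈ s, ∫⁻ t, expNeg (v (x i, t)) ∂ν ∂(P.map fun ω i => X i ω) := by
        refine lintegral_congr fun x => ?_
        rw [lintegral_map (f := fun t => Φ (x, t)) (hΦ.comp measurable_prodMk_left) hhm]
        exact lintegral_prod_comp_eq_prod_lintegral hm hlaw hi s
          fun i => hev.comp measurable_prodMk_left
    _ = ∫⁻ ω, ∏ i ∈ s, ∫⁻ t, expNeg (v (X i ω, t)) ∂ν ∂P :=
        lintegral_map (Finset.measurable_prod _ fun i _ =>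
          hev.lintegral_prod_right'.comp (measurable_pi_apply i)) hXm

theorem IsPoissonProcess.lintegral_expNeg_tsum_marked {Λ : Measure E} [SigmaFinite Λ]
    (hX : IsPoissonProcess P X Λ) (hm : ∀ i, Measurable (h i)) (hlaw : ∀ i, HasLaw (h i) ν P)
    (hi : iIndepFun h P) (hXh : IndepFun (fun ω i => X i ω) (fun ω i => h i ω) P)
    {v : E × F → ℝ≥0∞} (hv : Measurable v) :
    ∫⁻ ω, expNeg (∑' i, v (X i ω, h i ω)) ∂P =
      expNeg (∫⁻ p, (1 - expNeg (v p)) ∂(Λ.prod ν)) := by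
  have := hX.isProbabilityMeasure
  have : IsProbabilityMeasure ν := (hlaw 0).isProbabilityMeasure_iff.1 inferInstance
  have hev : Measurable fun p => expNeg (v p) := measurable_expNeg.comp hv
  have hle (y : E) : ∫⁻ t, expNeg (v (y, t)) ∂ν ≤ 1 :=
    (lintegral_mono fun t => expNeg_le_one _).trans (by simp)
  -- Averaging over the marks amounts to evaluating the unmarked process at `V`.
  let V (y : E) : ℝ≥0∞ := (-ENNReal.log (∫⁻ t, expNeg (v (y, t)) ∂ν)).toENNReal
  have hVm : Measurable V := hev.lintegral_prod_right'.ennreal_log.neg.ereal_toENNReal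
  have hV (y : E) : expNeg (V y) = ∫⁻ t, expNeg (v (y, t)) ∂ν := expNeg_toENNReal_neg_log (hle y)
  have hmarked := tendsto_lintegral_expNeg (P := P)
    (f := fun k ω => ∑ i ∈ Finset.range k, v (X i ω, h i ω))
    (fun k => Finset.measurable_sum _ fun i _ => hv.comp ((hX.measurable i).prodMk (hm i)))
    fun ω => ENNReal.tendsto_nat_tsum fun i => v (X i ω, h i ω)
  have hunmarked := tendsto_lintegral_expNeg (P := P)
    (f := fun k ω => ∑ i ∈ Finset.range k, V (X i ω))
    (fun k => Finset.measurable_sum _ fun i _ => hVm.comp (hX.measurable i))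
    fun ω => ENNReal.tendsto_nat_tsum fun i => V (X i ω)
  simp_rw [lintegral_expNeg_sum_marks hX.measurable hm hlaw hi hXh hv] at hmarked
  simp_rw [expNeg_sum, hV] at hunmarked
  rw [tendsto_nhds_unique hmarked hunmarked, hX.lintegral_expNeg_tsum hVm,
    lintegral_prod (fun p => 1 - expNeg (v p)) (measurable_const.sub hev).aemeasurable]
  congr 1
  refine lintegral_congr fun y => ?_
  rw [hV, lintegral_sub (g := fun t => expNeg (v (y, t))) (hev.comp measurable_prodMk_left)
    (ne_top_of_le_ne_top ENNReal.one_ne_top (hle y)) (.of_forall fun t => expNeg_le_one _),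
    lintegral_one, measure_univ]

end Marking

/-- The random measure `η` is a Poisson random measure with intensity measure `μ`: it takes values
in `{0, 1, …, ∞}` and its Laplace functional is the Poisson one. The law is encoded by the Laplace
functional, rather than by counts, because the latter are recovered from it jointly with integrals
over the complement. -/
structure IsPoissonRandomMeasure {Ω E : Type*} [MeasurableSpace Ω] [MeasurableSpace E]
    (P : Measure Ω) (η : Ω → Measure E) (μ : Measure E) : Prop where
  measurable : Measurable η
  integer : ∀ ω B, MeasurableSet B → ∃ k : ℕ∞, η ω B = k
  laplace : ∀ w : E → ℝ≥0∞, Measurable w →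
    ∫⁻ ω, expNeg (∫⁻ z, w z ∂(η ω)) ∂P = expNeg (∫⁻ z, (1 - expNeg (w z)) ∂μ)

lemma sum_dirac_apply_eq_pointCount {Ω E : Type*} [MeasurableSpace E] (X : ℕ → Ω → E) (ω : Ω)
    {B : Set E} (hB : MeasurableSet B) :
    Measure.sum (fun i => Measure.dirac (X i ω)) B = (pointCount X B ω : ℝ≥0∞) := by
  rw [Measure.sum_apply _ hB, ← one_mul (pointCount X B ω : ℝ≥0∞), ← tsum_indicator_const_comp]
  exact tsum_congr fun i => Measure.dirac_apply' _ hB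

section Transformations

variable {Ω E F : Type*} [MeasurableSpace Ω] [MeasurableSpace E] [MeasurableSpace F]
  {P : Measure Ω} {η : Ω → Measure E} {μ : Measure E}

theorem IsPoissonProcess.isPoissonRandomMeasure_marked {X : ℕ → Ω → E} {h : ℕ → Ω → F}
    {ν : Measure F} [SigmaFinite μ] (hX : IsPoissonProcess P X μ) (hm : ∀ i, Measurable (h i))
    (hlaw : ∀ i, HasLaw (h i) ν P) (hi : iIndepFun h P)
    (hXh : IndepFun (fun ω i => X i ω) (fun ω i => h i ω) P) :
    IsPoissonRandomMeasure P (fun ω => Measure.sum fun i => Measure.dirac (X i ω, h i ω))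
      (μ.prod ν) where
  measurable := Measure.measurable_of_measurable_coe _ fun B hB => by
    simp_rw [Measure.sum_apply _ hB]
    exact Measurable.tsum fun i => (Measure.measurable_coe hB).comp
      (Measure.measurable_dirac.comp ((hX.measurable i).prodMk (hm i)))
  integer ω _ hB := ⟨_, sum_dirac_apply_eq_pointCount (fun i ω => (X i ω, h i ω)) ω hB⟩
  laplace w hw := by
    simp_rw [lintegral_sum_measure, lintegral_dirac' _ hw]
    exact hX.lintegral_expNeg_tsum_marked hm hlaw hi hXh hw

lemma IsPoissonRandomMeasure.restrict (H : IsPoissonRandomMeasure P η μ) {S : Set E}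
    (hS : MeasurableSet S) :
    IsPoissonRandomMeasure P (fun ω => (η ω).restrict S) (μ.restrict S) where
  measurable := Measure.measurable_of_measurable_coe _ fun B hB => by
    simp_rw [Measure.restrict_apply hB]
    exact (Measure.measurable_coe (hB.inter hS)).comp H.measurable
  integer ω B hB := by
    rw [Measure.restrict_apply hB]
    exact H.integer ω _ (hB.inter hS)
  laplace w hw := by
    simp_rw [← lintegral_indicator hS]
    rw [H.laplace _ (hw.indicator hS)]
    congr 1
    refine lintegral_congr fun z => ?_
    by_cases hz : z ∈ S <;> simp [hz, expNeg_zero]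

lemma IsPoissonRandomMeasure.map (H : IsPoissonRandomMeasure P η μ) {f : E → F}
    (hf : Measurable f) : IsPoissonRandomMeasure P (fun ω => (η ω).map f) (μ.map f) where
  measurable := (Measure.measurable_map f hf).comp H.measurable
  integer ω B hB := by
    rw [Measure.map_apply hf hB]
    exact H.integer ω _ (hf hB)
  laplace w hw := by
    simp_rw [lintegral_map hw hf]
    rw [lintegral_map (f := fun z => 1 - expNeg (w z))
      (measurable_const.sub (measurable_expNeg.comp hw)) hf]
    exact H.laplace _ (hw.comp hf)

end Transformations

section InversePower

lemma measurable_polarAngle : Measurable polarAngle := by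
  have harg : Measurable fun v : Plane => Complex.arg ⟨v 0, v 1⟩ := by
    have hcoord : Measurable fun v : Plane => (v 0, v 1) := by fun_prop
    exact Complex.measurable_arg.comp
      (Complex.measurableEquivRealProd.symm.measurable.comp hcoord)
  exact Measurable.ite (measurableSet_le measurable_const harg) harg (harg.add_const _)

/-- Positions with gains `(y, t)` that the receiver at `x` sees within its reception angle `φ`. -/
def visible (φ : ℝ) (x : Plane) : Set (Plane × ℝ) := {p | polarAngle (p.1 - x) ≤ φ}

lemma measurableSet_visible (φ : ℝ) (x : Plane) : MeasurableSet (visible φ x) :=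
  measurableSet_le (measurable_polarAngle.comp (measurable_fst.sub_const x)) measurable_const

/-- The inverse received power as a function of position and gain. -/
noncomputable def markInvPower (α : ℝ) (x : Plane) (p : Plane × ℝ) : ℝ := ‖p.1 - x‖ ^ α / p.2

lemma measurable_markInvPower (α : ℝ) (x : Plane) : Measurable (markInvPower α x) := by
  unfold markInvPower
  fun_prop

/-- The point configuration on `ℝ` formed by the inverse received powers of the visible nodes, as a
sum of Dirac masses. -/
noncomputable def invPowerMeasure {Ω : Type*} (α φ : ℝ) (x : Plane) (X : ℕ → Ω → Plane)
    (h : ℕ → Ω → ℝ) (ω : Ω) : Measure ℝ :=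
  ((Measure.sum fun i => Measure.dirac (X i ω, h i ω)).restrict (visible φ x)).map
    (markInvPower α x)

lemma invPowerMeasure_apply {Ω : Type*} (α φ : ℝ) (x : Plane) (X : ℕ → Ω → Plane)
    (h : ℕ → Ω → ℝ) (ω : Ω) {B : Set ℝ} (hB : MeasurableSet B) :
    invPowerMeasure α φ x X h ω B =
      ({i : ℕ | polarAngle (X i ω - x) ≤ φ ∧ invPower α x X h i ω ∈ B}.encard : ℝ≥0∞) := by
  have hpre := measurable_markInvPower α x hB
  rw [invPowerMeasure, Measure.map_apply (measurable_markInvPower α x) hB,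
    Measure.restrict_apply hpre, inter_comm,
    sum_dirac_apply_eq_pointCount (fun i ω => (X i ω, h i ω)) ω
      ((measurableSet_visible φ x).inter hpre)]
  rfl

theorem IsPoissonNetwork.isPoissonRandomMeasure_invPowerMeasure {Ω : Type*} [MeasurableSpace Ω]
    {P : Measure Ω} {lam : ℝ} {ν : Measure ℝ} {X : ℕ → Ω → Plane} {h : ℕ → Ω → ℝ}
    (hnet : IsPoissonNetwork P lam ν X h) (α φ : ℝ) (x : Plane) :
    IsPoissonRandomMeasure P (invPowerMeasure α φ x X h)
      ((((ENNReal.ofReal lam • (volume : Measure Plane)).prod ν).restrict (visible φ x)).map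
        (markInvPower α x)) :=
  have : SigmaFinite (ENNReal.ofReal lam • (volume : Measure Plane)) :=
    inferInstanceAs (SigmaFinite (lam.toNNReal • (volume : Measure Plane)))
  ((hnet.nodes.isPoissonRandomMeasure_marked hnet.gain_measurable hnet.gain_law hnet.gain_indep
    hnet.gains_indep_nodes).restrict (measurableSet_visible φ x)).map (measurable_markInvPower α x)

end InversePower

section GeneratingFunction

lemma expNeg_mul_eq_tsum_indicator {Ω : Type*} {N : Ω → ℝ≥0∞} (V : Ω → ℝ≥0∞) {r : ℝ≥0∞}
    (hr : r ≠ 0) {ω : Ω} (hN : ∃ k : ℕ∞, N ω = k) :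
    expNeg (r * N ω) * V ω = ∑' k : ℕ, {ω | N ω = k}.indicator V ω * expNeg r ^ k := by
  obtain ⟨j, hj⟩ := hN
  induction j using ENat.recTopCoe with
  | top =>
    have hzero (k : ℕ) : {ω | N ω = k}.indicator V ω = 0 := indicator_of_notMem (by simp [hj]) _
    simp only [hj, ENat.toENNReal_top, ENNReal.mul_top hr, expNeg_top, hzero, zero_mul, tsum_zero]
  | coe j =>
    rw [ENat.toENNReal_coe] at hj
    rw [tsum_eq_single j, indicator_of_mem (by simpa using hj), hj, expNeg_mul_natCast, mul_comm]
    intro k hk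
    rw [indicator_of_notMem, zero_mul]
    simpa [hj] using hk.symm

variable {Ω : Type*} [MeasurableSpace Ω] {P : Measure Ω} {N V : Ω → ℝ≥0∞}

lemma lintegral_expNeg_mul_eq_tsum (hN : Measurable N) (hint : ∀ ω, ∃ k : ℕ∞, N ω = k)
    (hV : Measurable V) {r : ℝ≥0∞} (hr : r ≠ 0) :
    ∫⁻ ω, expNeg (r * N ω) * V ω ∂P =
      ∑' k : ℕ, (∫⁻ ω in {ω | N ω = k}, V ω ∂P) * expNeg r ^ k := by
  have hms (k : ℕ) : MeasurableSet {ω | N ω = k} := hN (measurableSet_singleton _)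
  simp_rw [fun ω => expNeg_mul_eq_tsum_indicator V hr (hint ω)]
  rw [lintegral_tsum fun k => ((hV.indicator (hms k)).mul_const _).aemeasurable]
  refine tsum_congr fun k => ?_
  rw [lintegral_mul_const _ (hV.indicator (hms k)), lintegral_indicator (hms k)]

lemma tsum_setLIntegral_eq_natCast_le (hN : Measurable N) :
    ∑' k : ℕ, ∫⁻ ω in {ω | N ω = k}, V ω ∂P ≤ ∫⁻ ω, V ω ∂P := by
  have hms (k : ℕ) : MeasurableSet {ω | N ω = k} := hN (measurableSet_singleton _)
  rw [← lintegral_iUnion hms]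
  · exact setLIntegral_le_lintegral _ _
  · exact fun k l hkl => disjoint_left.2 fun ω (hk : N ω = k) (hl : N ω = l) =>
      hkl (Nat.cast_injective (hk.symm.trans hl))

lemma setLIntegral_eq_mul_poissonWeight (hN : Measurable N) (hint : ∀ ω, ∃ k : ℕ∞, N ω = k)
    (hV : Measurable V) {C : ℝ≥0∞} (hC : C ≠ ∞) {m : ℝ} (hm : 0 ≤ m)
    (hgen : ∀ r, ∫⁻ ω, expNeg (r * N ω) * V ω ∂P = C * expNeg (ENNReal.ofReal m * (1 - expNeg r)))
    (k : ℕ) :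
    ∫⁻ ω in {ω | N ω = k}, V ω ∂P = C * ENNReal.ofReal (poissonWeight m k) := by
  have hweights := tsum_ofReal_poissonWeight_mul_pow hm le_rfl
  have hVC : ∫⁻ ω, V ω ∂P = C := by simpa [expNeg_zero] using hgen 0
  refine congrFun (eq_of_tsum_mul_pow_eq_of_ne_top
    (ne_top_of_le_ne_top (hVC ▸ hC) (tsum_setLIntegral_eq_natCast_le hN))
    (b := fun k => C * ENNReal.ofReal (poissonWeight m k)) ?_ fun q _ hq1 => ?_) k
  · simp only [one_pow, mul_one] at hweights
    rw [ENNReal.tsum_mul_left, hweights]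
    exact ENNReal.mul_ne_top hC (expNeg_ne_top _)
  · have hr := expNeg_toENNReal_neg_log hq1.le
    have hr0 : (-ENNReal.log q).toENNReal ≠ 0 := fun h => by
      rw [h, expNeg_zero] at hr
      exact hq1.ne' hr
    have hseries := lintegral_expNeg_mul_eq_tsum (P := P) hN hint hV hr0
    rw [hgen, hr] at hseries
    simp_rw [mul_assoc C]
    rw [← hseries, ENNReal.tsum_mul_left, tsum_ofReal_poissonWeight_mul_pow hm hq1.le]

end GeneratingFunction

section PoissonCounts

section Indicator

variable {E : Type*} [MeasurableSpace E] (κ : Measure E) {A : Set E}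

lemma lintegral_indicator_add (hA : MeasurableSet A) (a : ℝ≥0∞) (w : E → ℝ≥0∞) :
    ∫⁻ z, (A.indicator (fun _ => a) z + w z) ∂κ = a * κ A + ∫⁻ z, w z ∂κ := by
  rw [lintegral_add_left (measurable_const.indicator hA), lintegral_indicator_const hA]

lemma lintegral_one_sub_expNeg_indicator_add (hA : MeasurableSet A) {w : E → ℝ≥0∞}
    (hwA : ∀ z ∈ A, w z = 0) (a : ℝ≥0∞) :
    ∫⁻ z, (1 - expNeg (A.indicator (fun _ => a) z + w z)) ∂κ =
      (1 - expNeg a) * κ A + ∫⁻ z, (1 - expNeg (w z)) ∂κ := by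
  rw [← lintegral_indicator_add κ hA]
  refine lintegral_congr fun z => ?_
  by_cases hz : z ∈ A
  · simp [hz, hwA z hz, expNeg_zero]
  · simp [hz]

end Indicator

variable {Ω E : Type*} [MeasurableSpace Ω] [MeasurableSpace E] {P : Measure Ω}
  {η : Ω → Measure E} {μ : Measure E}

namespace IsPoissonRandomMeasure

lemma isProbabilityMeasure (H : IsPoissonRandomMeasure P η μ) : IsProbabilityMeasure P :=
  ⟨by simpa [expNeg_zero] using H.laplace 0 measurable_zero⟩

lemma measurable_apply (H : IsPoissonRandomMeasure P η μ) {A : Set E} (hA : MeasurableSet A) :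
    Measurable fun ω => η ω A :=
  (Measure.measurable_coe hA).comp H.measurable

lemma measurable_lintegral (H : IsPoissonRandomMeasure P η μ) {w : E → ℝ≥0∞} (hw : Measurable w) :
    Measurable fun ω => ∫⁻ z, w z ∂(η ω) :=
  (Measure.measurable_lintegral hw).comp H.measurable

lemma ae_lintegral_ne_top (H : IsPoissonRandomMeasure P η μ) {w : E → ℝ≥0∞} (hw : Measurable w)
    (hμ : ∫⁻ z, w z ∂μ ≠ ∞) : ∀ᵐ ω ∂P, ∫⁻ z, w z ∂(η ω) ≠ ∞ := by
  have := H.isProbabilityMeasure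
  have hms : MeasurableSet {ω | ∫⁻ z, w z ∂(η ω) ≠ ∞} :=
    (H.measurable_lintegral hw (measurableSet_singleton ∞)).compl
  have hle (k : ℕ) : expNeg ((k : ℝ≥0∞)⁻¹ * ∫⁻ z, w z ∂μ) ≤ P {ω | ∫⁻ z, w z ∂(η ω) ≠ ∞} :=
    calc expNeg ((k : ℝ≥0∞)⁻¹ * ∫⁻ z, w z ∂μ)
        ≤ expNeg (∫⁻ z, (1 - expNeg ((k : ℝ≥0∞)⁻¹ * w z)) ∂μ) := antitone_expNeg <| by
          rw [← lintegral_const_mul _ hw]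
          exact lintegral_mono fun z => one_sub_expNeg_le _
      _ = ∫⁻ ω, expNeg ((k : ℝ≥0∞)⁻¹ * ∫⁻ z, w z ∂(η ω)) ∂P := by
          simp_rw [← H.laplace _ (hw.const_mul _), lintegral_const_mul _ hw]
      _ ≤ ∫⁻ ω, {ω | ∫⁻ z, w z ∂(η ω) ≠ ∞}.indicator 1 ω ∂P := lintegral_mono fun ω => by
          by_cases hω : ∫⁻ z, w z ∂(η ω) = ∞
          · rw [hω, ENNReal.mul_top (by simp), expNeg_top]
            exact zero_le
          · rw [indicator_of_mem (by exact hω)]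
            exact expNeg_le_one _
      _ = P {ω | ∫⁻ z, w z ∂(η ω) ≠ ∞} := lintegral_indicator_one hms
  have hlim : Tendsto (fun k : ℕ => expNeg ((k : ℝ≥0∞)⁻¹ * ∫⁻ z, w z ∂μ)) atTop (𝓝 1) := by
    have hmul := ENNReal.Tendsto.mul_const ENNReal.tendsto_inv_nat_nhds_zero (.inr hμ)
    rw [zero_mul] at hmul
    exact expNeg_zero ▸ (continuous_expNeg.tendsto 0).comp hmul
  exact (mem_ae_iff_prob_eq_one hms).2 (prob_le_one.antisymm (le_of_tendsto' hlim hle))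

lemma ae_apply_ne_top (H : IsPoissonRandomMeasure P η μ) {A : Set E} (hA : MeasurableSet A)
    (hμA : μ A ≠ ∞) : ∀ᵐ ω ∂P, η ω A ≠ ∞ := by
  simpa only [lintegral_indicator_one hA] using
    H.ae_lintegral_ne_top (measurable_one.indicator hA) (by rwa [lintegral_indicator_one hA])

lemma laplace_indicator_add (H : IsPoissonRandomMeasure P η μ) {A : Set E} (hA : MeasurableSet A)
    {w : E → ℝ≥0∞} (hw : Measurable w) (hwA : ∀ z ∈ A, w z = 0) (a : ℝ≥0∞) :
    ∫⁻ ω, expNeg (a * η ω A) * expNeg (∫⁻ z, w z ∂(η ω)) ∂P =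
      expNeg (∫⁻ z, (1 - expNeg (w z)) ∂μ) * expNeg (μ A * (1 - expNeg a)) := by
  have hlap := H.laplace _ ((measurable_const.indicator (f := fun _ => a) hA).add hw)
  simp only [Pi.add_apply] at hlap
  rw [lintegral_one_sub_expNeg_indicator_add μ hA hwA] at hlap
  simp only [lintegral_indicator_add _ hA, expNeg_add] at hlap
  rw [hlap, mul_comm, mul_comm (μ A)]

lemma setLIntegral_count_eq (H : IsPoissonRandomMeasure P η μ) {A : Set E}
    (hA : MeasurableSet A) (hμA : μ A ≠ ∞) {w : E → ℝ≥0∞} (hw : Measurable w)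
    (hwA : ∀ z ∈ A, w z = 0) (k : ℕ) :
    ∫⁻ ω in {ω | η ω A = k}, expNeg (∫⁻ z, w z ∂(η ω)) ∂P =
      expNeg (∫⁻ z, (1 - expNeg (w z)) ∂μ) * ENNReal.ofReal (poissonWeight (μ.real A) k) := by
  refine setLIntegral_eq_mul_poissonWeight (V := fun ω => expNeg (∫⁻ z, w z ∂(η ω)))
    (H.measurable_apply hA) (fun ω => H.integer ω A hA)
    (measurable_expNeg.comp (H.measurable_lintegral hw)) (expNeg_ne_top _) measureReal_nonneg
    (fun r => ?_) k
  rw [ofReal_measureReal hμA, H.laplace_indicator_add hA hw hwA]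

lemma setLIntegral_count_inter_count_eq (H : IsPoissonRandomMeasure P η μ) {A B : Set E}
    (hA : MeasurableSet A) (hB : MeasurableSet B) (hAB : Disjoint A B) (hμA : μ A ≠ ∞)
    (hμB : μ B ≠ ∞) {w : E → ℝ≥0∞} (hw : Measurable w) (hwA : ∀ z ∈ A, w z = 0)
    (hwB : ∀ z ∈ B, w z = 0) (k l : ℕ) :
    ∫⁻ ω in {ω | η ω A = k} ∩ {ω | η ω B = l}, expNeg (∫⁻ z, w z ∂(η ω)) ∂P =
      expNeg (∫⁻ z, (1 - expNeg (w z)) ∂μ) * ENNReal.ofReal (poissonWeight (μ.real A) k) *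
        ENNReal.ofReal (poissonWeight (μ.real B) l) := by
  have hNB := H.measurable_apply hB
  have hmsB : MeasurableSet {ω | η ω B = l} := hNB (measurableSet_singleton _)
  rw [inter_comm, ← Measure.restrict_restrict hmsB]
  refine setLIntegral_eq_mul_poissonWeight (V := fun ω => expNeg (∫⁻ z, w z ∂(η ω))) hNB
    (fun ω => H.integer ω B hB) (measurable_expNeg.comp (H.measurable_lintegral hw))
    (ENNReal.mul_ne_top (expNeg_ne_top _) ENNReal.ofReal_ne_top) measureReal_nonneg
    (fun r => ?_) l
  have hcount := H.setLIntegral_count_eq hA hμA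
    ((measurable_const.indicator (f := fun _ => r) hB).add hw) (fun z hz => by
      simp [hwA z hz, disjoint_left.1 hAB hz]) k
  simp only [Pi.add_apply] at hcount
  rw [lintegral_one_sub_expNeg_indicator_add μ hB hwB] at hcount
  simp only [lintegral_indicator_add _ hB, expNeg_add] at hcount
  rw [hcount, ofReal_measureReal hμB, mul_comm (μ B)]
  ring

lemma measure_count_eq (H : IsPoissonRandomMeasure P η μ) {A : Set E} (hA : MeasurableSet A)
    (hμA : μ A ≠ ∞) (k : ℕ) :
    P {ω | η ω A = k} = ENNReal.ofReal (poissonWeight (μ.real A) k) := by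
  simpa [expNeg_zero] using
    H.setLIntegral_count_eq hA hμA (w := 0) measurable_zero (fun _ _ => rfl) k

end IsPoissonRandomMeasure

end PoissonCounts

section PointConfigurations

/-- Configurations of infinitely many points of the line, finitely many of them to the left of any
number, encoded as integer valued measures. -/
structure IsPointConfiguration (η : Measure ℝ) : Prop where
  finite : ∀ a, η (Iic a) ≠ ∞
  infinite : η univ = ∞
  integer : ∀ B, MeasurableSet B → ∃ k : ℕ∞, η B = k

/-- The `n`-th smallest point of a point configuration on the line, counted from `n = 1` and with
multiplicity. -/
noncomputable def nthPoint (η : Measure ℝ) (n : ℕ) : ℝ := sInf {t : ℝ | (n : ℝ≥0∞) ≤ η (Iic t)}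

lemma ext_of_Iic_of_ne_top {μ κ : Measure ℝ} (hμ : ∀ a, μ (Iic a) ≠ ∞)
    (h : ∀ a, μ (Iic a) = κ (Iic a)) : μ = κ := by
  refine Measure.ext_of_generateFrom_of_iUnion (range Iic) (fun k : ℕ => Iic (k : ℝ))
    (borel_eq_generateFrom_Iic ℝ ▸ BorelSpace.measurable_eq) isPiSystem_Iic
    (iUnion_eq_univ_iff.2 fun z => exists_nat_ge z) (fun k => mem_range_self _) (fun k => hμ _) ?_
  rintro _ ⟨a, rfl⟩
  exact h a

lemma tsum_indicator_Iic_natCast_add_one (m : ℕ∞) :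
    ∑' k : ℕ, (Iic (m : ℝ≥0∞)).indicator (fun _ => (1 : ℝ≥0∞)) ((k + 1 : ℕ) : ℝ≥0∞) = m := by
  rw [tsum_indicator_const_comp (X := fun k (_ : Unit) => ((k + 1 : ℕ) : ℝ≥0∞)) (ω := ()), one_mul,
    pointCount]
  congr 1
  induction m using ENat.recTopCoe with
  | top => simp
  | coe m =>
    rw [show {k : ℕ | ((k + 1 : ℕ) : ℝ≥0∞) ∈ Iic ((m : ℕ∞) : ℝ≥0∞)} = Finset.range m by
      ext k; simp [-Nat.cast_add], encard_coe_eq_coe_finsetCard,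
      Finset.card_range]

namespace IsPointConfiguration

variable {η : Measure ℝ}

lemma exists_natCast_le (H : IsPointConfiguration η) (n : ℕ) :
    ∃ t : ℝ, (n : ℝ≥0∞) ≤ η (Iic t) := by
  have hlim := tendsto_measure_Iic_atTop η
  rw [H.infinite] at hlim
  exact (hlim.eventually (le_mem_nhds (ENNReal.natCast_lt_top n))).exists

lemma bddBelow (H : IsPointConfiguration η) {n : ℕ} (hn : n ≠ 0) :
    BddBelow {t : ℝ | (n : ℝ≥0∞) ≤ η (Iic t)} := by
  have hlim := tendsto_measure_iInter_atBot (μ := η) (s := fun t : ℝ => Iic t)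
    (fun t => measurableSet_Iic.nullMeasurableSet) (fun _ _ => Iic_subset_Iic.2) ⟨0, H.finite 0⟩
  rw [show ⋂ t : ℝ, Iic t = ∅ from iInter_Iic_eq_empty_iff.2 (by simp), measure_empty] at hlim
  obtain ⟨b, hb⟩ := (hlim.eventually (gt_mem_nhds one_pos)).exists
  refine ⟨b, fun t (ht : (n : ℝ≥0∞) ≤ η (Iic t)) => le_of_not_ge fun htb => ?_⟩
  have hone : (1 : ℝ≥0∞) ≤ n := Nat.one_le_cast.2 (Nat.one_le_iff_ne_zero.2 hn)
  exact (hone.trans (ht.trans (measure_mono (Iic_subset_Iic.2 htb)))).not_gt hb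

lemma nthPoint_le_iff (H : IsPointConfiguration η) {n : ℕ} (hn : n ≠ 0) {t : ℝ} :
    nthPoint η n ≤ t ↔ (n : ℝ≥0∞) ≤ η (Iic t) := by
  refine ⟨fun h => ?_, fun h => csInf_le (H.bddBelow hn) h⟩
  have hgt (y : ℝ) (hy : t < y) : (n : ℝ≥0∞) ≤ η (Iic y) := by
    obtain ⟨u, hu, huy⟩ := exists_lt_of_csInf_lt (H.exists_natCast_le n) (h.trans_lt hy)
    exact le_trans hu (measure_mono (Iic_subset_Iic.2 huy.le))
  have hlim := tendsto_measure_biInter_gt (μ := η) (s := Iic) (a := t)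
    (fun y _ => measurableSet_Iic.nullMeasurableSet) (fun _ _ _ => Iic_subset_Iic.2)
    ⟨t + 1, by simp, H.finite _⟩
  have hInter : ⋂ y > t, Iic y = Iic t := by
    ext y
    simpa using forall_gt_imp_ge_iff_le_of_dense
  rw [hInter] at hlim
  exact ge_of_tendsto hlim (eventually_mem_nhdsWithin.mono hgt)

theorem eq_sum_dirac_nthPoint (H : IsPointConfiguration η) :
    η = Measure.sum fun k => Measure.dirac (nthPoint η (k + 1)) := by
  refine ext_of_Iic_of_ne_top H.finite fun t => ?_
  obtain ⟨m, hm⟩ := H.integer (Iic t) measurableSet_Iic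
  rw [Measure.sum_apply _ measurableSet_Iic, hm, ← tsum_indicator_Iic_natCast_add_one]
  refine tsum_congr fun k => ?_
  rw [Measure.dirac_apply' _ measurableSet_Iic, ← hm]
  by_cases hk : ((k + 1 : ℕ) : ℝ≥0∞) ≤ η (Iic t)
  · rw [indicator_of_mem (by exact hk),
      indicator_of_mem (by exact (H.nthPoint_le_iff k.succ_ne_zero).2 hk), Pi.one_apply]
  · rw [indicator_of_notMem (by exact hk), indicator_of_notMem
      (by exact fun h => hk ((H.nthPoint_le_iff k.succ_ne_zero).1 h))]

lemma tsum_comp_nthPoint (H : IsPointConfiguration η) {n : ℕ} {b : ℝ} (hb : η (Iic b) = n)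
    {w : ℝ → ℝ≥0∞} (hw : Measurable w) :
    ∑' k : ℕ, w (nthPoint η (n + 1 + k)) = ∫⁻ z in Ioi b, w z ∂η := by
  have hle (k : ℕ) : nthPoint η (k + 1) ≤ b ↔ k + 1 ≤ n := by
    rw [H.nthPoint_le_iff k.succ_ne_zero, hb, Nat.cast_le]
  have hsum : ∫⁻ z in Ioi b, w z ∂η = ∑' k, (Ioi b).indicator w (nthPoint η (k + 1)) := by
    rw [← lintegral_indicator measurableSet_Ioi]
    conv_lhs => rw [H.eq_sum_dirac_nthPoint]
    simp_rw [lintegral_sum_measure, lintegral_dirac' _ (hw.indicator measurableSet_Ioi)]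
  rw [hsum, eq_comm, ← Summable.sum_add_tsum_nat_add' (k := n) ENNReal.summable,
    Finset.sum_eq_zero, zero_add]
  · refine tsum_congr fun k => ?_
    rw [show n + 1 + k = k + n + 1 by omega]
    refine indicator_of_mem ?_ w
    exact not_le.1 fun h => absurd ((hle _).1 h) (by omega)
  · intro k hk
    exact indicator_of_notMem (not_lt.2 ((hle k).2 (Finset.mem_range.1 hk))) _

end IsPointConfiguration

end PointConfigurations

section PoissonWeightCalculus

lemma continuous_poissonWeight (m : ℕ) : Continuous fun u => poissonWeight u m := by
  unfold poissonWeight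
  fun_prop

lemma measurable_ofReal_poissonWeight (m : ℕ) :
    Measurable fun u => ENNReal.ofReal (poissonWeight u m) :=
  (continuous_poissonWeight m).measurable.ennreal_ofReal

lemma tendsto_poissonWeight_atTop (m : ℕ) :
    Tendsto (fun u => poissonWeight u m) atTop (𝓝 0) := by
  have hlim := (Real.tendsto_pow_mul_exp_neg_atTop_nhds_zero m).div_const (m.factorial : ℝ)
  rw [zero_div] at hlim
  exact hlim.congr fun u => by rw [poissonWeight, mul_comm]

lemma mul_poissonWeight (u : ℝ) (m : ℕ) :
    u * poissonWeight u m = (m + 1) * poissonWeight u (m + 1) := by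
  rw [poissonWeight, poissonWeight, Nat.factorial_succ]
  push_cast
  field_simp
  ring

lemma hasDerivAt_poissonWeight_succ (u : ℝ) (m : ℕ) :
    HasDerivAt (fun u => poissonWeight u (m + 1))
      (poissonWeight u m - poissonWeight u (m + 1)) u := by
  have hexp : HasDerivAt (fun u : ℝ => Real.exp (-u)) (Real.exp (-u) * -1) u :=
    (hasDerivAt_neg u).exp
  refine ((hexp.mul (hasDerivAt_pow (m + 1) u)).div_const _).congr_deriv ?_
  rw [poissonWeight, poissonWeight, Nat.factorial_succ]
  push_cast
  field_simp
  ring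

lemma hasDerivAt_sum_poissonWeight (u : ℝ) (m : ℕ) :
    HasDerivAt (fun u => ∑ k ∈ Finset.range (m + 1), poissonWeight u k) (-poissonWeight u m) u := by
  induction m with
  | zero => simpa [poissonWeight] using (hasDerivAt_neg u).exp
  | succ m ih =>
    simp_rw [Finset.sum_range_succ _ (m + 1)]
    exact (ih.add (hasDerivAt_poissonWeight_succ u m)).congr_deriv (by ring)

lemma lintegral_Ioi_poissonWeight {a : ℝ} (ha : 0 ≤ a) (m : ℕ) :
    ∫⁻ u in Ioi a, ENNReal.ofReal (poissonWeight u m) =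
      ENNReal.ofReal (∑ k ∈ Finset.range (m + 1), poissonWeight a k) := by
  have hderiv (u : ℝ) (_ : u ∈ Ici a) :=
    (hasDerivAt_sum_poissonWeight u m).fun_neg.congr_deriv (neg_neg _)
  have hnonneg (u : ℝ) (hu : u ∈ Ioi a) : 0 ≤ poissonWeight u m :=
    poissonWeight_nonneg (ha.trans hu.le) m
  have hlim : Tendsto (fun u => -∑ k ∈ Finset.range (m + 1), poissonWeight u k) atTop (𝓝 0) := by
    simpa using (tendsto_finsetSum (Finset.range (m + 1)) fun k _ =>
      tendsto_poissonWeight_atTop k).neg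
  rw [← ofReal_integral_eq_lintegral_ofReal
    (integrableOn_Ioi_deriv_of_nonneg' hderiv hnonneg hlim)
    ((ae_restrict_iff' measurableSet_Ioi).2 (.of_forall hnonneg)),
    integral_Ioi_of_hasDerivAt_of_nonneg' hderiv hnonneg hlim, zero_sub, neg_neg]

lemma lintegral_Ioi_zero_poissonWeight (m : ℕ) :
    ∫⁻ u in Ioi 0, ENNReal.ofReal (poissonWeight u m) = 1 := by
  rw [lintegral_Ioi_poissonWeight le_rfl, Finset.sum_range_succ', Finset.sum_eq_zero]
  · simp [poissonWeight]
  · exact fun k _ => by simp [poissonWeight]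

end PoissonWeightCalculus

section DiffuseIntensity

/-- Diffuse measures on the line that are infinite, but finite to the left of any number: the
intensity measures for which the points of a Poisson random measure are almost surely an infinite
increasing sequence. -/
structure IsDiffuseIntensity (μ : Measure ℝ) : Prop where
  diffuse : ∀ z, μ {z} = 0
  finite : ∀ z, μ (Iic z) ≠ ∞
  infinite : μ univ = ∞

/-- The law of the `(m + 1)`-st point of a Poisson random measure on the line with intensity
`μ`: its density with respect to `μ` is the probability of `m` points to the left. -/
noncomputable def nthPointLaw (μ : Measure ℝ) (m : ℕ) : Measure ℝ :=
  μ.withDensity fun z => ENNReal.ofReal (poissonWeight (μ.real (Iic z)) m)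

namespace IsDiffuseIntensity

variable {μ : Measure ℝ}

lemma monotone_measureReal_Iic (H : IsDiffuseIntensity μ) : Monotone fun z => μ.real (Iic z) :=
  fun _ _ hyz => measureReal_mono (Iic_subset_Iic.2 hyz) (H.finite _)

lemma measurable_measureReal_Iic (H : IsDiffuseIntensity μ) : Measurable fun z => μ.real (Iic z) :=
  H.monotone_measureReal_Iic.measurable

lemma continuous_measureReal_Iic (H : IsDiffuseIntensity μ) :
    Continuous fun z => μ.real (Iic z) := by
  refine continuous_iff_continuousAt.2 fun z =>
    (ENNReal.tendsto_toReal (H.finite z)).comp ?_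
  refine tendsto_measure_of_ae_tendsto_indicator (𝓝 z) measurableSet_Iic
    (fun _ => measurableSet_Iic) (measurableSet_Iic (a := z + 1)) (H.finite _) ?_ ?_
  · filter_upwards [Iio_mem_nhds (lt_add_one z)] with y hy using Iic_subset_Iic.2 (le_of_lt hy)
  · have hne : ∀ᵐ u ∂μ, u ≠ z := by simpa [ae_iff] using H.diffuse z
    filter_upwards [hne] with u hu
    obtain hu | hu := hu.lt_or_gt
    · filter_upwards [Ioi_mem_nhds hu] with y hy
      exact iff_of_true (mem_Iic.2 (le_of_lt hy)) (mem_Iic.2 hu.le)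
    · filter_upwards [Iio_mem_nhds hu] with y hy
      exact iff_of_false (notMem_Iic.2 hy) (notMem_Iic.2 hu)

lemma tendsto_measureReal_Iic_atBot (H : IsDiffuseIntensity μ) :
    Tendsto (fun z => μ.real (Iic z)) atBot (𝓝 0) := by
  have hlim : Tendsto (fun z => μ (Iic z)) atBot (𝓝 (μ ∅)) :=
    tendsto_measure_of_ae_tendsto_indicator atBot MeasurableSet.empty
      (fun _ => measurableSet_Iic) (measurableSet_Iic (a := 0)) (H.finite _)
      ((eventually_le_atBot 0).mono fun _ => Iic_subset_Iic.2)
      (.of_forall fun u => (eventually_lt_atBot u).mono fun _ hy =>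
        iff_of_false (not_le.2 hy) (notMem_empty u))
  rw [measure_empty] at hlim
  exact (ENNReal.tendsto_toReal ENNReal.zero_ne_top).comp hlim

lemma tendsto_measureReal_Iic_atTop (H : IsDiffuseIntensity μ) :
    Tendsto (fun z => μ.real (Iic z)) atTop atTop := by
  have hlim := tendsto_measure_Iic_atTop μ
  rw [H.infinite] at hlim
  refine ENNReal.tendsto_ofReal_nhds_top.1 (hlim.congr fun z => ?_)
  exact (ofReal_measureReal (H.finite z)).symm

lemma exists_measureReal_Iic_eq (H : IsDiffuseIntensity μ) {u : ℝ} (hu : 0 < u) :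
    ∃ z, μ.real (Iic z) = u := by
  obtain ⟨y, hy⟩ := (H.tendsto_measureReal_Iic_atBot.eventually_le_const hu).exists
  obtain ⟨z, hz⟩ := (H.tendsto_measureReal_Iic_atTop.eventually_ge_atTop u).exists
  exact mem_range_of_exists_le_of_exists_ge H.continuous_measureReal_Iic ⟨y, hy⟩ ⟨z, hz⟩

lemma measure_measureReal_Iic_le (H : IsDiffuseIntensity μ) {u : ℝ} (hu : 0 ≤ u) :
    μ {z | μ.real (Iic z) ≤ u} = ENNReal.ofReal u := by
  have hIic {v : ℝ} (z : ℝ) (hz : μ.real (Iic z) = v) : μ (Iic z) = ENNReal.ofReal v := by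
    rw [← hz, ofReal_measureReal (H.finite z)]
  refine le_antisymm (ENNReal.le_of_forall_pos_le_add fun ε hε _ => ?_) ?_
  · obtain ⟨z, hz⟩ := H.exists_measureReal_Iic_eq (u := u + ε) (by positivity)
    rw [← ENNReal.ofReal_coe_nnreal, ← ENNReal.ofReal_add hu ε.coe_nonneg, ← hIic z hz]
    refine measure_mono fun y (hy : μ.real (Iic y) ≤ u) => mem_Iic.2 (le_of_not_gt fun hzy => ?_)
    have hle : u + ε ≤ u := hz ▸ (H.monotone_measureReal_Iic hzy.le).trans hy
    exact hle.not_gt (lt_add_of_pos_right u hε)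
  · obtain rfl | hu := hu.eq_or_lt
    · simp
    · obtain ⟨z, hz⟩ := H.exists_measureReal_Iic_eq hu
      rw [← hIic z hz]
      exact measure_mono fun y (hy : y ≤ z) => hz ▸ H.monotone_measureReal_Iic hy

theorem map_measureReal_Iic (H : IsDiffuseIntensity μ) :
    μ.map (fun z => μ.real (Iic z)) = volume.restrict (Ioi 0) := by
  refine (ext_of_Iic_of_ne_top (fun u => ?_) fun u => ?_).symm
  · rw [Measure.restrict_apply measurableSet_Iic, Iic_inter_Ioi]
    simp
  · rw [Measure.restrict_apply measurableSet_Iic, Iic_inter_Ioi, Real.volume_Ioc, sub_zero,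
      Measure.map_apply H.measurable_measureReal_Iic measurableSet_Iic]
    obtain hu | hu := lt_or_ge u 0
    · rw [ENNReal.ofReal_of_nonpos hu.le, eq_comm]
      convert measure_empty (μ := μ)
      exact eq_empty_of_forall_notMem fun z (hz : _ ≤ u) =>
        (hz.trans_lt hu).not_ge measureReal_nonneg
    · exact (H.measure_measureReal_Iic_le hu).symm

lemma lintegral_comp_measureReal_Iic (H : IsDiffuseIntensity μ) {g : ℝ → ℝ≥0∞}
    (hg : Measurable g) : ∫⁻ z, g (μ.real (Iic z)) ∂μ = ∫⁻ u in Ioi 0, g u := by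
  rw [← H.map_measureReal_Iic, lintegral_map hg H.measurable_measureReal_Iic]

lemma setLIntegral_Ioi_comp_measureReal_Iic (H : IsDiffuseIntensity μ) {g : ℝ → ℝ≥0∞}
    (hg : Measurable g) (t : ℝ) :
    ∫⁻ z in Ioi t, g (μ.real (Iic z)) ∂μ = ∫⁻ u in Ioi (μ.real (Iic t)), g u := by
  have hne : ∀ᵐ z ∂μ, μ.real (Iic z) ≠ μ.real (Iic t) := by
    refine ae_of_ae_map (p := (· ≠ μ.real (Iic t))) H.measurable_measureReal_Iic.aemeasurable ?_
    rw [H.map_measureReal_Iic]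
    exact ae_restrict_of_ae (Measure.ae_ne volume _)
  calc ∫⁻ z in Ioi t, g (μ.real (Iic z)) ∂μ
      = ∫⁻ z, (Ioi (μ.real (Iic t))).indicator g (μ.real (Iic z)) ∂μ := by
        rw [← lintegral_indicator measurableSet_Ioi]
        refine lintegral_congr_ae (hne.mono fun z hz => ?_)
        obtain htz | hzt := lt_or_ge t z
        · rw [indicator_of_mem (mem_Ioi.2 htz)]
          exact (indicator_of_mem ((H.monotone_measureReal_Iic htz.le).lt_of_ne' hz) g).symm
        · rw [indicator_of_notMem (notMem_Ioi.2 hzt)]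
          exact (indicator_of_notMem (not_lt.2 (H.monotone_measureReal_Iic hzt)) g).symm
    _ = ∫⁻ u in Ioi (μ.real (Iic t)), g u := by
        rw [H.lintegral_comp_measureReal_Iic (hg.indicator measurableSet_Ioi),
          lintegral_indicator measurableSet_Ioi, Measure.restrict_restrict measurableSet_Ioi,
          inter_eq_left.2 (Ioi_subset_Ioi measureReal_nonneg)]

lemma nthPointLaw_Ioi (H : IsDiffuseIntensity μ) (m : ℕ) (t : ℝ) :
    nthPointLaw μ m (Ioi t) =
      ENNReal.ofReal (∑ k ∈ Finset.range (m + 1), poissonWeight (μ.real (Iic t)) k) := by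
  rw [nthPointLaw, withDensity_apply _ measurableSet_Ioi,
    H.setLIntegral_Ioi_comp_measureReal_Iic (measurable_ofReal_poissonWeight m),
    lintegral_Ioi_poissonWeight measureReal_nonneg]

lemma isProbabilityMeasure_nthPointLaw (H : IsDiffuseIntensity μ) (m : ℕ) :
    IsProbabilityMeasure (nthPointLaw μ m) := by
  refine ⟨?_⟩
  rw [nthPointLaw, withDensity_apply _ MeasurableSet.univ, setLIntegral_univ,
    H.lintegral_comp_measureReal_Iic (measurable_ofReal_poissonWeight m),
    lintegral_Ioi_zero_poissonWeight]

lemma lintegral_nthPointLaw (H : IsDiffuseIntensity μ) (m : ℕ) {g : ℝ → ℝ≥0∞}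
    (hg : Measurable g) :
    ∫⁻ z, g z ∂(nthPointLaw μ m) =
      ∫⁻ z, ENNReal.ofReal (poissonWeight (μ.real (Iic z)) m) * g z ∂μ :=
  lintegral_withDensity_eq_lintegral_mul _
    ((measurable_ofReal_poissonWeight m).comp H.measurable_measureReal_Iic) hg

lemma lintegral_measureReal_Iic_nthPointLaw (H : IsDiffuseIntensity μ) (m : ℕ) :
    ∫⁻ z, ENNReal.ofReal (μ.real (Iic z)) ∂(nthPointLaw μ m) = ENNReal.ofReal (m + 1) := by
  have hweight (z : ℝ) : ENNReal.ofReal (poissonWeight (μ.real (Iic z)) m) *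
      ENNReal.ofReal (μ.real (Iic z)) =
      ENNReal.ofReal (m + 1) * ENNReal.ofReal (poissonWeight (μ.real (Iic z)) (m + 1)) := by
    rw [← ENNReal.ofReal_mul (poissonWeight_nonneg measureReal_nonneg m),
      ← ENNReal.ofReal_mul (by positivity), mul_comm, mul_poissonWeight]
  rw [H.lintegral_nthPointLaw m H.measurable_measureReal_Iic.ennreal_ofReal]
  simp_rw [hweight]
  rw [H.lintegral_comp_measureReal_Iic ((measurable_ofReal_poissonWeight (m + 1)).const_mul _),
    lintegral_const_mul _ (measurable_ofReal_poissonWeight (m + 1)),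
    lintegral_Ioi_zero_poissonWeight, mul_one]

lemma integrable_measureReal_Iic_nthPointLaw (H : IsDiffuseIntensity μ) (m : ℕ) :
    Integrable (fun z => μ.real (Iic z)) (nthPointLaw μ m) :=
  (lintegral_ofReal_ne_top_iff_integrable H.measurable_measureReal_Iic.aestronglyMeasurable
    (.of_forall fun _ => measureReal_nonneg)).1 (by
      rw [H.lintegral_measureReal_Iic_nthPointLaw]; exact ENNReal.ofReal_ne_top)

theorem integral_measureReal_Iic_nthPointLaw (H : IsDiffuseIntensity μ) (m : ℕ) :
    ∫ z, μ.real (Iic z) ∂(nthPointLaw μ m) = m + 1 := by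
  rw [integral_eq_lintegral_of_nonneg_ae (.of_forall fun _ => measureReal_nonneg)
    H.measurable_measureReal_Iic.aestronglyMeasurable, H.lintegral_measureReal_Iic_nthPointLaw,
    ENNReal.toReal_ofReal (by positivity)]

end IsDiffuseIntensity

end DiffuseIntensity

section PoissonPoints

variable {Ω : Type*} [MeasurableSpace Ω] {P : Measure Ω} {η : Ω → Measure ℝ} {μ : Measure ℝ}

namespace IsPoissonRandomMeasure

lemma ae_apply_eq_top (H : IsPoissonRandomMeasure P η μ) {A : Set ℝ} (hA : MeasurableSet A)
    (hμA : μ A = ∞) : ∀ᵐ ω ∂P, η ω A = ∞ := by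
  have hone : expNeg 1 < 1 := by simp [expNeg]
  have hlaplace : ∫⁻ ω, expNeg (η ω A) ∂P = 0 := by
    simpa [hμA, expNeg_zero, expNeg_top, ENNReal.top_mul, (tsub_pos_of_lt hone).ne'] using
      H.laplace_indicator_add hA (w := 0) measurable_zero (fun _ _ => rfl) 1
  filter_upwards [(lintegral_eq_zero_iff
    (measurable_expNeg.comp (H.measurable_apply hA))).1 hlaplace] with ω hω
  by_contra hne
  exact expNeg_ne_zero hne hω

lemma ae_isPointConfiguration (H : IsPoissonRandomMeasure P η μ) (hμ : IsDiffuseIntensity μ) :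
    ∀ᵐ ω ∂P, IsPointConfiguration (η ω) := by
  have hfin : ∀ᵐ ω ∂P, ∀ k : ℕ, η ω (Iic (k : ℝ)) ≠ ∞ :=
    ae_all_iff.2 fun k => H.ae_apply_ne_top measurableSet_Iic (hμ.finite _)
  filter_upwards [hfin, H.ae_apply_eq_top MeasurableSet.univ hμ.infinite] with ω hω_fin hω_inf
  refine ⟨fun a => ?_, hω_inf, H.integer ω⟩
  obtain ⟨k, hk⟩ := exists_nat_ge a
  exact measure_ne_top_of_subset (Iic_subset_Iic.2 hk) (hω_fin k)

lemma aemeasurable_nthPoint (H : IsPoissonRandomMeasure P η μ) (hμ : IsDiffuseIntensity μ)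
    {n : ℕ} (hn : n ≠ 0) : AEMeasurable (fun ω => nthPoint (η ω) n) P := by
  have hnull (t : ℝ) : NullMeasurableSet {ω | nthPoint (η ω) n ≤ t} P := by
    have hms : MeasurableSet {ω | (n : ℝ≥0∞) ≤ η ω (Iic t)} :=
      measurableSet_le measurable_const (H.measurable_apply measurableSet_Iic)
    refine hms.nullMeasurableSet.congr ?_
    filter_upwards [H.ae_isPointConfiguration hμ] with ω hω
    exact propext (hω.nthPoint_le_iff hn).symm
  exact NullMeasurable.aemeasurable (measurable_of_Iic (δ := NullMeasurableSpace Ω P) hnull)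

lemma ae_lt_nthPoint_iff (H : IsPoissonRandomMeasure P η μ) (hμ : IsDiffuseIntensity μ) (m : ℕ)
    (t : ℝ) : ∀ᵐ ω ∂P, t < nthPoint (η ω) (m + 1) ↔
      ω ∈ ⋃ k ∈ Finset.range (m + 1), {ω | η ω (Iic t) = k} := by
  filter_upwards [H.ae_isPointConfiguration hμ] with ω hω
  obtain ⟨j, hj⟩ := hω.integer (Iic t) measurableSet_Iic
  have hjtop := hω.finite t
  rw [← not_le, hω.nthPoint_le_iff m.succ_ne_zero]
  simp only [hj, mem_iUnion, mem_ofPred_eq, exists_prop, Finset.mem_range] at hjtop ⊢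
  induction j using ENat.recTopCoe with
  | top => exact absurd rfl hjtop
  | coe j =>
    simp only [ENat.toENNReal_coe, Nat.cast_le, Nat.cast_inj, exists_eq_right', not_le]

theorem map_nthPoint (H : IsPoissonRandomMeasure P η μ) (hμ : IsDiffuseIntensity μ) (m : ℕ) :
    P.map (fun ω => nthPoint (η ω) (m + 1)) = nthPointLaw μ m := by
  have := H.isProbabilityMeasure
  have := hμ.isProbabilityMeasure_nthPointLaw m
  have hZ : AEMeasurable (fun ω => nthPoint (η ω) (m + 1)) P :=
    H.aemeasurable_nthPoint hμ m.succ_ne_zero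
  have := Measure.isProbabilityMeasure_map (μ := P) hZ
  have hms (t : ℝ) (k : ℕ) : MeasurableSet {ω | η ω (Iic t) = k} :=
    H.measurable_apply measurableSet_Iic (measurableSet_singleton _)
  have hIoi (t : ℝ) :
      P.map (fun ω => nthPoint (η ω) (m + 1)) (Ioi t) = nthPointLaw μ m (Ioi t) := by
    have hcongr : P ((fun ω => nthPoint (η ω) (m + 1)) ⁻¹' Ioi t) =
        P (⋃ k ∈ Finset.range (m + 1), {ω | η ω (Iic t) = k}) :=
      measure_congr (eventuallyEq_set.2 (H.ae_lt_nthPoint_iff hμ m t))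
    rw [Measure.map_apply_of_aemeasurable hZ measurableSet_Ioi, hμ.nthPointLaw_Ioi, hcongr,
      measure_biUnion_finset (fun k _ l _ hkl => ?_) fun k _ => hms t k,
      ENNReal.ofReal_sum_of_nonneg fun k _ => poissonWeight_nonneg measureReal_nonneg k]
    · simp_rw [H.measure_count_eq measurableSet_Iic (hμ.finite t)]
    · exact disjoint_left.2 fun ω (hk : η ω (Iic t) = k) (hl : η ω (Iic t) = l) =>
        hkl (Nat.cast_injective (hk.symm.trans hl))
  refine ext_of_Iic_of_ne_top (fun z => measure_ne_top _ _) fun t => ?_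
  rw [← compl_Ioi, prob_compl_eq_one_sub measurableSet_Ioi,
    prob_compl_eq_one_sub measurableSet_Ioi, hIoi t]

end IsPoissonRandomMeasure

end PoissonPoints

section TailLowerBound

/-- The conditional Laplace exponent of `∑ w` over the points beyond `z` of a Poisson random measure
with intensity `μ`, given that `z` is one of its points. -/
noncomputable def tailExponent (μ : Measure ℝ) (w : ℝ → ℝ≥0∞) (z : ℝ) : ℝ≥0∞ :=
  ∫⁻ y in Ioi z, (1 - expNeg (w y)) ∂μ

lemma antitone_tailExponent (μ : Measure ℝ) (w : ℝ → ℝ≥0∞) : Antitone (tailExponent μ w) :=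
  fun _ _ h => lintegral_mono_set (Ioi_subset_Ioi h)

lemma measurable_expNeg_tailExponent (μ : Measure ℝ) (w : ℝ → ℝ≥0∞) :
    Measurable fun z => expNeg (tailExponent μ w z) :=
  measurable_expNeg.comp (antitone_tailExponent μ w).measurable

/-- The event that the `(m + 1)`-st point is the only one in `(a, b]`. -/
def onlyPointIn {Ω : Type*} (η : Ω → Measure ℝ) (m : ℕ) (a b : ℝ) : Set Ω :=
  {ω | η ω (Iic a) = m} ∩ {ω | η ω (Ioc a b) = (1 : ℕ)}

lemma measure_Iic_of_mem_onlyPointIn {Ω : Type*} {η : Ω → Measure ℝ} {m : ℕ} {a b : ℝ}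
    (hab : a ≤ b) {ω : Ω} (hω : ω ∈ onlyPointIn η m a b) : η ω (Iic b) = (m + 1 : ℕ) := by
  have ha : η ω (Iic a) = m := hω.1
  have hb : η ω (Ioc a b) = (1 : ℕ) := hω.2
  rw [← Iic_union_Ioc_eq_Iic hab, measure_union (Iic_disjoint_Ioc le_rfl) measurableSet_Ioc, ha, hb,
    Nat.cast_add]

lemma disjoint_onlyPointIn {Ω : Type*} (η : Ω → Measure ℝ) (m : ℕ) {a b a' b' : ℝ} (hab : a ≤ b)
    (hba : b ≤ a') : Disjoint (onlyPointIn η m a b) (onlyPointIn η m a' b') := by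
  refine disjoint_left.2 fun ω hω hω' => ?_
  have hle : η ω (Iic b) ≤ η ω (Iic a') := measure_mono (Iic_subset_Iic.2 hba)
  rw [measure_Iic_of_mem_onlyPointIn hab hω, show η ω (Iic a') = m from hω'.1, Nat.cast_le] at hle
  exact hle.not_gt m.lt_succ_self

variable {Ω : Type*} [MeasurableSpace Ω] {P : Measure Ω} {η : Ω → Measure ℝ} {μ : Measure ℝ}
  {w : ℝ → ℝ≥0∞}

lemma poissonWeight_mul_poissonWeight_one (u v : ℝ) (m : ℕ) :
    poissonWeight u m * poissonWeight v 1 = Real.exp (-(u + v)) * u ^ m / m.factorial * v := by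
  rw [poissonWeight, poissonWeight, neg_add, Real.exp_add]
  simp only [pow_one, Nat.factorial_one, Nat.cast_one, div_one]
  ring

/-- A lower bound for the density of `nthPointLaw μ m` on intervals of length `p` about `z`. -/
noncomputable def nthPointLowerDensity (μ : Measure ℝ) (m : ℕ) (p z : ℝ) : ℝ :=
  Real.exp (-μ.real (Iic (z + p))) * μ.real (Iic (z - p)) ^ m / m.factorial

namespace IsPoissonRandomMeasure

lemma measurableSet_onlyPointIn (H : IsPoissonRandomMeasure P η μ) (m : ℕ) (a b : ℝ) :
    MeasurableSet (onlyPointIn η m a b) :=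
  (H.measurable_apply measurableSet_Iic (measurableSet_singleton _)).inter
    (H.measurable_apply measurableSet_Ioc (measurableSet_singleton _))

lemma setLIntegral_onlyPointIn (H : IsPoissonRandomMeasure P η μ) (hμ : IsDiffuseIntensity μ)
    (hw : Measurable w) (m : ℕ) {a b : ℝ} (hab : a ≤ b) :
    ∫⁻ ω in onlyPointIn η m a b, expNeg (∑' k : ℕ, w (nthPoint (η ω) (m + 1 + 1 + k))) ∂P =
      ENNReal.ofReal (Real.exp (-μ.real (Iic b)) * μ.real (Iic a) ^ m / m.factorial) *
        expNeg (tailExponent μ w b) * μ (Ioc a b) := by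
  have hμ_Ioc : μ (Ioc a b) ≠ ∞ := measure_ne_top_of_subset Ioc_subset_Iic_self (hμ.finite b)
  have hadd : μ.real (Iic a) + μ.real (Ioc a b) = μ.real (Iic b) := by
    rw [← Iic_union_Ioc_eq_Iic hab,
      measureReal_union (Iic_disjoint_Ioc le_rfl) measurableSet_Ioc (hμ.finite a) hμ_Ioc]
  have hcount := H.setLIntegral_count_inter_count_eq measurableSet_Iic measurableSet_Ioc
    (Iic_disjoint_Ioc le_rfl) (hμ.finite a) hμ_Ioc (hw.indicator (measurableSet_Ioi (a := b)))
    (fun z (hz : z ≤ a) => indicator_of_notMem (notMem_Ioi.2 (hz.trans hab)) w)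
    (fun z hz => indicator_of_notMem (notMem_Ioi.2 hz.2) w) m 1
  have htail : ∫⁻ z, (1 - expNeg ((Ioi b).indicator w z)) ∂μ = tailExponent μ w b := by
    rw [tailExponent, ← lintegral_indicator measurableSet_Ioi]
    refine lintegral_congr fun z => ?_
    by_cases hz : z ∈ Ioi b <;> simp [hz, expNeg_zero]
  simp_rw [lintegral_indicator measurableSet_Ioi] at hcount
  rw [htail, mul_assoc, ← ENNReal.ofReal_mul (poissonWeight_nonneg measureReal_nonneg m),
    poissonWeight_mul_poissonWeight_one, hadd, ENNReal.ofReal_mul (by positivity),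
    ofReal_measureReal hμ_Ioc] at hcount
  rw [mul_right_comm, mul_comm, ← hcount]
  refine setLIntegral_congr_fun_ae (H.measurableSet_onlyPointIn m a b) ?_
  filter_upwards [H.ae_isPointConfiguration hμ] with ω hω hωE
  rw [hω.tsum_comp_nthPoint (measure_Iic_of_mem_onlyPointIn hab hωE) hw]

lemma setLIntegral_nthPointLowerDensity_le (H : IsPoissonRandomMeasure P η μ)
    (hμ : IsDiffuseIntensity μ) (hw : Measurable w) (m : ℕ) {a b p : ℝ} (hab : a ≤ b)
    (hbp : b ≤ a + p) :
    ∫⁻ z in Ioc a b, ENNReal.ofReal (nthPointLowerDensity μ m p z) *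
        expNeg (tailExponent μ w z) ∂μ ≤
      ∫⁻ ω in onlyPointIn η m a b, expNeg (∑' k : ℕ, w (nthPoint (η ω) (m + 1 + 1 + k))) ∂P := by
  rw [H.setLIntegral_onlyPointIn hμ hw m hab, ← setLIntegral_const]
  refine setLIntegral_mono' measurableSet_Ioc fun z hz => ?_
  have hexp : μ.real (Iic b) ≤ μ.real (Iic (z + p)) :=
    hμ.monotone_measureReal_Iic (by linarith [hz.1])
  have hpow : μ.real (Iic (z - p)) ≤ μ.real (Iic a) :=
    hμ.monotone_measureReal_Iic (by linarith [hz.2])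
  unfold nthPointLowerDensity
  gcongr
  exact antitone_expNeg (antitone_tailExponent μ w hz.2)

lemma lintegral_nthPointLowerDensity_le (H : IsPoissonRandomMeasure P η μ)
    (hμ : IsDiffuseIntensity μ) (hw : Measurable w) (m : ℕ) {p : ℝ} (hp : 0 < p) :
    ∫⁻ z, ENNReal.ofReal (nthPointLowerDensity μ m p z) * expNeg (tailExponent μ w z) ∂μ ≤
      ∫⁻ ω, expNeg (∑' k : ℕ, w (nthPoint (η ω) (m + 1 + 1 + k))) ∂P := by
  have hmono : Monotone fun j : ℤ => j • p := zsmul_left_mono hp.le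
  have hdisj : Pairwise (Function.onFun Disjoint fun j : ℤ =>
      onlyPointIn η m (j • p) ((j + 1) • p)) := by
    refine (pairwise_disjoint_on _).2 fun i j hij => ?_
    exact disjoint_onlyPointIn η m (hmono (lt_add_one i).le) (hmono hij)
  calc ∫⁻ z, ENNReal.ofReal (nthPointLowerDensity μ m p z) * expNeg (tailExponent μ w z) ∂μ
      = ∫⁻ z in ⋃ j : ℤ, Ioc (j • p) ((j + 1) • p),
          ENNReal.ofReal (nthPointLowerDensity μ m p z) * expNeg (tailExponent μ w z) ∂μ := by
        rw [iUnion_Ioc_zsmul hp, setLIntegral_univ]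
    _ ≤ ∑' j : ℤ, ∫⁻ z in Ioc (j • p) ((j + 1) • p),
          ENNReal.ofReal (nthPointLowerDensity μ m p z) * expNeg (tailExponent μ w z) ∂μ :=
        lintegral_iUnion_le _ _
    _ ≤ ∑' j : ℤ, ∫⁻ ω in onlyPointIn η m (j • p) ((j + 1) • p),
          expNeg (∑' k : ℕ, w (nthPoint (η ω) (m + 1 + 1 + k))) ∂P :=
        ENNReal.tsum_le_tsum fun j => H.setLIntegral_nthPointLowerDensity_le hμ hw m
          (hmono (lt_add_one j).le) (by rw [add_smul, one_smul])
    _ = ∫⁻ ω in ⋃ j : ℤ, onlyPointIn η m (j • p) ((j + 1) • p),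
          expNeg (∑' k : ℕ, w (nthPoint (η ω) (m + 1 + 1 + k))) ∂P :=
        (lintegral_iUnion (fun j => H.measurableSet_onlyPointIn m _ _) hdisj _).symm
    _ ≤ ∫⁻ ω, expNeg (∑' k : ℕ, w (nthPoint (η ω) (m + 1 + 1 + k))) ∂P :=
        setLIntegral_le_lintegral _ _

end IsPoissonRandomMeasure

lemma IsDiffuseIntensity.tendsto_nthPointLowerDensity (H : IsDiffuseIntensity μ) (m : ℕ) (z : ℝ) :
    Tendsto (fun p => nthPointLowerDensity μ m p z) (𝓝 0)
      (𝓝 (poissonWeight (μ.real (Iic z)) m)) := by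
  have hF := H.continuous_measureReal_Iic
  have hcont : Continuous fun p => nthPointLowerDensity μ m p z := by
    unfold nthPointLowerDensity
    have hadd : Continuous fun p => μ.real (Iic (z + p)) := hF.comp (continuous_const_add z)
    have hsub : Continuous fun p => μ.real (Iic (z - p)) :=
      hF.comp (continuous_const.sub continuous_id)
    fun_prop
  simpa [nthPointLowerDensity, poissonWeight] using hcont.tendsto 0

/-- The conditional law of the points beyond the `(m + 1)`-st one is Poisson, and the two sides are
in fact equal. The inequality `≤` is less work: by Fatou's lemma along partitions of the line into
short intervals, only the event that the `(m + 1)`-st point is alone in its interval matters. -/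
theorem IsPoissonRandomMeasure.lintegral_expNeg_tailExponent_le
    (H : IsPoissonRandomMeasure P η μ) (hμ : IsDiffuseIntensity μ) (hw : Measurable w) (m : ℕ) :
    ∫⁻ z, expNeg (tailExponent μ w z) ∂(nthPointLaw μ m) ≤
      ∫⁻ ω, expNeg (∑' k : ℕ, w (nthPoint (η ω) (m + 1 + 1 + k))) ∂P := by
  have hlim (z : ℝ) : Tendsto (fun N : ℕ => ENNReal.ofReal
      (nthPointLowerDensity μ m (1 / (N + 1)) z) * expNeg (tailExponent μ w z)) atTop
      (𝓝 (ENNReal.ofReal (poissonWeight (μ.real (Iic z)) m) * expNeg (tailExponent μ w z))) :=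
    ENNReal.Tendsto.mul_const (ENNReal.tendsto_ofReal ((hμ.tendsto_nthPointLowerDensity m z).comp
      tendsto_one_div_add_atTop_nhds_zero_nat)) (.inr (expNeg_ne_top _))
  have hmeas (p : ℝ) : Measurable (nthPointLowerDensity μ m p) := by
    unfold nthPointLowerDensity
    have hadd := hμ.measurable_measureReal_Iic.comp (measurable_add_const p)
    have hsub := hμ.measurable_measureReal_Iic.comp (measurable_sub_const p)
    exact ((Real.measurable_exp.comp hadd.neg).mul (hsub.pow_const m)).div_const _
  rw [hμ.lintegral_nthPointLaw m (measurable_expNeg_tailExponent μ w)]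
  refine (lintegral_congr fun z => (hlim z).liminf_eq.symm).trans_le ?_
  refine (lintegral_liminf_le fun N : ℕ => (hmeas _).ennreal_ofReal.mul
    (measurable_expNeg_tailExponent μ w)).trans ?_
  refine (liminf_le_liminf (.of_forall fun N : ℕ => H.lintegral_nthPointLowerDensity_le hμ hw m
    (p := 1 / (N + 1)) (by positivity))).trans_eq (liminf_const _)

end TailLowerBound

section PowerMeasure

/-- The measure on `(0, ∞)` that gives mass `c * z ^ δ` to `(0, z]`. -/
noncomputable def powerMeasure (c δ : ℝ) : Measure ℝ :=
  (volume.restrict (Ioi (0 : ℝ))).withDensity fun z => ENNReal.ofReal (c * δ * z ^ (δ - 1))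

variable {c δ : ℝ}

lemma powerMeasure_Iic (hc : 0 ≤ c) (hδ : 0 < δ) (z : ℝ) :
    powerMeasure c δ (Iic z) = ENNReal.ofReal (c * max z 0 ^ δ) := by
  have hInt : IntervalIntegrable (fun y : ℝ => c * δ * y ^ (δ - 1)) volume 0 (max z 0) :=
    (intervalIntegral.intervalIntegrable_rpow' (by linarith)).const_mul _
  have hIoc : Iic z ∩ Ioi 0 = Ioc 0 (max z 0) := by
    rw [Iic_inter_Ioi]
    ext y
    simp +contextual [not_le_of_gt]
  rw [powerMeasure, withDensity_apply _ measurableSet_Iic,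
    Measure.restrict_restrict measurableSet_Iic, hIoc, ← ofReal_integral_eq_lintegral_ofReal
      ((intervalIntegrable_iff_integrableOn_Ioc_of_le (le_max_right z 0)).1 hInt),
    ← intervalIntegral.integral_of_le (le_max_right z 0), intervalIntegral.integral_const_mul,
    integral_rpow (.inl (by linarith)), sub_add_cancel, Real.zero_rpow hδ.ne', sub_zero, mul_assoc,
    mul_div_cancel₀ _ hδ.ne']
  refine (ae_restrict_iff' measurableSet_Ioc).2 (.of_forall fun y hy => ?_)
  exact mul_nonneg (mul_nonneg hc hδ.le) (Real.rpow_nonneg hy.1.le _)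

lemma measureReal_powerMeasure_Iic (hc : 0 ≤ c) (hδ : 0 < δ) {z : ℝ} (hz : 0 ≤ z) :
    (powerMeasure c δ).real (Iic z) = c * z ^ δ := by
  rw [measureReal_def, powerMeasure_Iic hc hδ, max_eq_left hz,
    ENNReal.toReal_ofReal (by positivity)]

lemma ae_pos_powerMeasure (c δ : ℝ) : ∀ᵐ z ∂(powerMeasure c δ), 0 < z :=
  (withDensity_absolutelyContinuous _ _).ae_le (ae_restrict_mem measurableSet_Ioi)

lemma isDiffuseIntensity_powerMeasure (hc : 0 < c) (hδ : 0 < δ) :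
    IsDiffuseIntensity (powerMeasure c δ) where
  diffuse z := by
    refine (withDensity_absolutelyContinuous _ _).trans Measure.absolutelyContinuous_restrict ?_
    exact Real.volume_singleton
  finite z := by
    rw [powerMeasure_Iic hc.le hδ]
    exact ENNReal.ofReal_ne_top
  infinite := by
    refine tendsto_nhds_unique (tendsto_measure_Iic_atTop _) ?_
    simp_rw [powerMeasure_Iic hc.le hδ]
    refine ENNReal.tendsto_ofReal_nhds_top.2 (((tendsto_rpow_atTop hδ).const_mul_atTop hc).comp ?_)
    exact tendsto_atTop_mono (fun z => le_max_left z 0) tendsto_id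

end PowerMeasure

section Sector

lemma lintegral_Ioc_zero_ofReal {r : ℝ} (hr : 0 ≤ r) :
    ∫⁻ ρ in Ioc 0 r, ENNReal.ofReal ρ = ENNReal.ofReal (r ^ 2 / 2) := by
  have hInt : IntegrableOn (fun ρ : ℝ => ρ) (Ioc 0 r) := continuous_id.integrableOn_Ioc
  rw [← ofReal_integral_eq_lintegral_ofReal hInt
    ((ae_restrict_iff' measurableSet_Ioc).2 (.of_forall fun ρ hρ => hρ.1.le)),
    ← intervalIntegral.integral_of_le hr]
  simp

lemma volume_arg_mem_inter_norm_le {S : Set ℝ} (hS : MeasurableSet S) {r : ℝ} (hr : 0 ≤ r) :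
    volume {w : ℂ | Complex.arg w ∈ S ∧ ‖w‖ ≤ r} =
      ENNReal.ofReal (r ^ 2 / 2) * volume (S ∩ Ioo (-Real.pi) Real.pi) := by
  have hsector : MeasurableSet {w : ℂ | Complex.arg w ∈ S ∧ ‖w‖ ≤ r} :=
    (Complex.measurable_arg hS).inter (measurableSet_le measurable_norm measurable_const)
  have hpolar (p : ℝ × ℝ) (hp : p ∈ polarCoord.target) :
      ENNReal.ofReal p.1 • {w : ℂ | Complex.arg w ∈ S ∧ ‖w‖ ≤ r}.indicator (1 : ℂ → ℝ≥0∞)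
        (Complex.polarCoord.symm p) =
      (Iic r).indicator ENNReal.ofReal p.1 * S.indicator (1 : ℝ → ℝ≥0∞) p.2 := by
    have harg : Complex.arg (Complex.polarCoord.symm p) = p.2 := by
      rw [Complex.polarCoord_symm_apply, Complex.ofReal_cos, Complex.ofReal_sin]
      exact Complex.arg_mul_cos_add_sin_mul_I hp.1 ⟨hp.2.1, hp.2.2.le⟩
    have hnorm : ‖Complex.polarCoord.symm p‖ = p.1 := by
      rw [Complex.norm_polarCoord_symm, abs_of_pos hp.1]
    by_cases hθ : p.2 ∈ S <;> by_cases hρ : p.1 ≤ r <;>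
      simp only [indicator, mem_ofPred_eq, mem_Iic, harg, hnorm, hθ, hρ, and_true, and_false,
        if_true, if_false, smul_eq_mul, mul_zero, mul_one, Pi.one_apply]
  rw [← lintegral_indicator_one hsector, ← Complex.lintegral_comp_polarCoord_symm,
    setLIntegral_congr_fun polarCoord.open_target.measurableSet hpolar, polarCoord_target,
    Measure.volume_eq_prod, ← Measure.prod_restrict, lintegral_prod_mul
      (ENNReal.measurable_ofReal.indicator measurableSet_Iic).aemeasurable
      (measurable_one.indicator hS).aemeasurable,
    lintegral_indicator_one hS, Measure.restrict_apply hS, lintegral_indicator measurableSet_Iic,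
    Measure.restrict_restrict measurableSet_Iic, Iic_inter_Ioi, lintegral_Ioc_zero_ofReal hr]

/-- The arguments in `(-π, π]` of the vectors whose `polarAngle`, which is their argument in
`[0, 2π)`, is at most `φ`. -/
def argSector (φ : ℝ) : Set ℝ := {θ | (if 0 ≤ θ then θ else θ + 2 * Real.pi) ≤ φ}

lemma measurableSet_argSector (φ : ℝ) : MeasurableSet (argSector φ) :=
  measurableSet_le (Measurable.ite measurableSet_Ici measurable_id (measurable_id.add_const _))
    measurable_const

lemma volume_argSector_inter_Ioo {φ : ℝ} (hφ : φ ≤ 2 * Real.pi) :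
    volume (argSector φ ∩ Ioo (-Real.pi) Real.pi) = ENNReal.ofReal φ := by
  have hπ := Real.pi_pos
  obtain h | h := lt_or_ge φ Real.pi
  · have hIcc : argSector φ ∩ Ioo (-Real.pi) Real.pi = Icc 0 φ := by
      ext θ
      simp only [argSector, mem_inter_iff, mem_ofPred_eq, mem_Ioo, mem_Icc]
      grind
    rw [hIcc, Real.volume_Icc, sub_zero]
  · have hsdiff : argSector φ ∩ Ioo (-Real.pi) Real.pi =
        Ioo (-Real.pi) Real.pi \ Ioo (φ - 2 * Real.pi) 0 := by
      ext θ
      simp only [argSector, mem_inter_iff, mem_ofPred_eq, mem_Ioo, Set.mem_sdiff]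
      grind
    rw [hsdiff, measure_sdiff (Ioo_subset_Ioo (by linarith) hπ.le)
      measurableSet_Ioo.nullMeasurableSet (by simp), Real.volume_Ioo, Real.volume_Ioo,
      ← ENNReal.ofReal_sub _ (by linarith)]
    ring_nf

lemma volume_polarAngle_le_inter_norm_le {φ r : ℝ} (hφ : φ ≤ 2 * Real.pi) (hr : 0 ≤ r)
    (x : Plane) :
    volume {y : Plane | polarAngle (y - x) ≤ φ ∧ ‖y - x‖ ≤ r} =
      ENNReal.ofReal (φ / 2 * r ^ 2) := by
  have hsector : MeasurableSet {w : ℂ | Complex.arg w ∈ argSector φ ∧ ‖w‖ ≤ r} :=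
    (Complex.measurable_arg (measurableSet_argSector φ)).inter
      (measurableSet_le measurable_norm measurable_const)
  have hmp : MeasurePreserving
      (fun y : Plane => Complex.measurableEquivPi.symm (WithLp.ofLp (y - x))) volume volume :=
    (Complex.volume_preserving_equiv_pi.symm.comp (PiLp.volume_preserving_ofLp (Fin 2))).comp
      (measurePreserving_sub_right volume x)
  have hcoord (v : Plane) : Complex.measurableEquivPi.symm (WithLp.ofLp v) = ⟨v 0, v 1⟩ := by
    rw [Complex.measurableEquivPi_symm_apply]
    apply Complex.ext <;> simp
  have hnorm (v : Plane) : ‖(⟨v 0, v 1⟩ : ℂ)‖ = ‖v‖ := by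
    rw [EuclideanSpace.norm_eq, Complex.norm_def, Complex.normSq_mk]
    simp [Fin.sum_univ_two, sq]
  have hpre : {y : Plane | polarAngle (y - x) ≤ φ ∧ ‖y - x‖ ≤ r} =
      (fun y : Plane => Complex.measurableEquivPi.symm (WithLp.ofLp (y - x))) ⁻¹'
        {w : ℂ | Complex.arg w ∈ argSector φ ∧ ‖w‖ ≤ r} := by
    ext y
    rw [mem_preimage, hcoord, mem_ofPred_eq, mem_ofPred_eq, hnorm]
    rfl
  rw [hpre, hmp.measure_preimage hsector.nullMeasurableSet,
    volume_arg_mem_inter_norm_le (measurableSet_argSector φ) hr, volume_argSector_inter_Ioo hφ,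
    ← ENNReal.ofReal_mul (by positivity)]
  ring_nf

end Sector

section NetworkIntensity

variable {α φ : ℝ}

lemma volume_polarAngle_le_inter_invPower_le (hα : 0 < α) (hφ : φ ≤ 2 * Real.pi) (x : Plane)
    {t : ℝ} (ht : 0 < t) (z : ℝ) :
    volume {y : Plane | polarAngle (y - x) ≤ φ ∧ ‖y - x‖ ^ α / t ≤ z} =
      ENNReal.ofReal (φ / 2 * (max z 0 ^ (2 / α) * t ^ (2 / α))) := by
  obtain hz | hz := lt_or_ge z 0
  · have hempty : {y : Plane | polarAngle (y - x) ≤ φ ∧ ‖y - x‖ ^ α / t ≤ z} = ∅ :=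
      eq_empty_of_forall_notMem fun y hy => (hy.2.trans_lt hz).not_ge (by positivity)
    rw [hempty, measure_empty, max_eq_right hz.le, Real.zero_rpow (by positivity)]
    simp
  · have hiff (y : Plane) : ‖y - x‖ ^ α / t ≤ z ↔ ‖y - x‖ ≤ (z * t) ^ α⁻¹ := by
      rw [div_le_iff₀ ht, Real.le_rpow_inv_iff_of_pos (norm_nonneg _) (by positivity) hα]
    simp_rw [hiff]
    rw [volume_polarAngle_le_inter_norm_le hφ (by positivity), max_eq_left hz,
      ← Real.mul_rpow hz ht.le, ← Real.rpow_mul_natCast (by positivity), Nat.cast_ofNat,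
      inv_mul_eq_div]

lemma lintegral_rpow_eq_gainMoment {ν : Measure ℝ} (hν_pos : ∀ᵐ t ∂ν, 0 < t)
    (hν_int : Integrable (fun t : ℝ => t ^ (2 / α)) ν) :
    ∫⁻ t, ENNReal.ofReal (t ^ (2 / α)) ∂ν = ENNReal.ofReal (gainMoment α ν) :=
  (ofReal_integral_eq_lintegral_ofReal hν_int
    (hν_pos.mono fun _ ht => Real.rpow_nonneg ht.le _)).symm

theorem map_markInvPower_restrict_visible {lam : ℝ} (hlam : 0 ≤ lam) (hα : 0 < α) (hφ0 : 0 ≤ φ)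
    (hφ : φ ≤ 2 * Real.pi) {ν : Measure ℝ} [SFinite ν] (hν_pos : ∀ᵐ t ∂ν, 0 < t)
    (hν_int : Integrable (fun t : ℝ => t ^ (2 / α)) ν) (x : Plane) :
    (((ENNReal.ofReal lam • (volume : Measure Plane)).prod ν).restrict (visible φ x)).map
        (markInvPower α x) = powerMeasure (1 / 2 * gainMoment α ν * φ * lam) (2 / α) := by
  have hmoment : 0 ≤ gainMoment α ν :=
    integral_nonneg_of_ae (hν_pos.mono fun t ht => Real.rpow_nonneg ht.le _)
  have hIic (z : ℝ) := powerMeasure_Iic (c := 1 / 2 * gainMoment α ν * φ * lam)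
    (by positivity) (show 0 < 2 / α by positivity) z
  refine (ext_of_Iic_of_ne_top (fun z => hIic z ▸ ENNReal.ofReal_ne_top) fun z => ?_).symm
  have hpre := measurable_markInvPower α x (measurableSet_Iic (a := z))
  have hslice : ∀ᵐ t ∂ν,
      volume ((fun y => (y, t)) ⁻¹' (markInvPower α x ⁻¹' Iic z ∩ visible φ x)) =
      ENNReal.ofReal (φ / 2 * max z 0 ^ (2 / α)) * ENNReal.ofReal (t ^ (2 / α)) := by
    filter_upwards [hν_pos] with t ht
    rw [← ENNReal.ofReal_mul (by positivity), mul_assoc,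
      ← volume_polarAngle_le_inter_invPower_le hα hφ x ht z]
    exact congrArg volume (Set.ext fun y => and_comm)
  rw [hIic, Measure.map_apply (measurable_markInvPower α x) measurableSet_Iic,
    Measure.restrict_apply hpre, Measure.prod_apply_symm (hpre.inter (measurableSet_visible φ x))]
  simp_rw [Measure.smul_apply, smul_eq_mul]
  rw [lintegral_const_mul' _ _ ENNReal.ofReal_ne_top, lintegral_congr_ae hslice,
    lintegral_const_mul' _ _ ENNReal.ofReal_ne_top, lintegral_rpow_eq_gainMoment hν_pos hν_int,
    ← ENNReal.ofReal_mul (by positivity), ← ENNReal.ofReal_mul hlam]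
  ring_nf

end NetworkIntensity

section LowerGamma

lemma continuousAt_rpow_mul_exp_neg (a : ℝ) {t : ℝ} (ht : 0 < t) :
    ContinuousAt (fun t : ℝ => t ^ a * Real.exp (-t)) t :=
  (Real.continuousAt_rpow_const t a (.inl ht.ne')).mul (by fun_prop)

lemma integrableOn_Ioi_rpow_mul_exp_neg (a : ℝ) {b : ℝ} (hb : 0 < b) :
    IntegrableOn (fun t : ℝ => t ^ a * Real.exp (-t)) (Ioi b) := by
  simp_rw [mul_comm _ (Real.exp _)]
  refine integrable_of_isBigO_exp_neg (b := 1 / 2) (by norm_num) (fun t ht => ?_)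
    (Real.Gamma_integrand_isLittleO a).isBigO
  simpa only [mul_comm] using
    (continuousAt_rpow_mul_exp_neg a (hb.trans_le ht)).continuousWithinAt

lemma hasDerivAt_lowerGamma (a : ℝ) {b : ℝ} (hb : 0 < b) :
    HasDerivAt (lowerGamma a) (b ^ (a - 1) * Real.exp (-b)) b := by
  obtain ⟨d, hd0, hdb⟩ := exists_between hb
  have hint := integrableOn_Ioi_rpow_mul_exp_neg (a - 1) hd0
  have hprimitive : HasDerivAt (fun y => ∫ t in d..y, t ^ (a - 1) * Real.exp (-t))
      (b ^ (a - 1) * Real.exp (-b)) b :=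
    intervalIntegral.integral_hasDerivAt_right
      ((intervalIntegrable_iff_integrableOn_Ioc_of_le hdb.le).2 (hint.mono_set Ioc_subset_Ioi_self))
      ⟨Ioi d, Ioi_mem_nhds hdb, hint.aestronglyMeasurable⟩ (continuousAt_rpow_mul_exp_neg _ hb)
  refine (hprimitive.const_add (lowerGamma a d)).congr_of_eventuallyEq ?_
  filter_upwards [Ioi_mem_nhds hdb] with y (hy : d < y)
  rw [lowerGamma, lowerGamma, ← intervalIntegral.integral_Ioi_sub_Ioi hint hy.le]
  ring

lemma lowerGamma_add_one {a b : ℝ} (ha : a ≠ 0) (hb : 0 < b) :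
    lowerGamma (a + 1) b = a * lowerGamma a b - b ^ a * Real.exp (-b) := by
  have hint := (integrableOn_Ioi_rpow_mul_exp_neg (a - 1) hb).const_mul a
  have hint' := integrableOn_Ioi_rpow_mul_exp_neg (a + 1 - 1) hb
  have hderiv : ∀ t ∈ Ioi b, HasDerivAt (fun t : ℝ => t ^ a * Real.exp (-t))
      (a * (t ^ (a - 1) * Real.exp (-t)) - t ^ (a + 1 - 1) * Real.exp (-t)) t := fun t ht => by
    refine ((Real.hasDerivAt_rpow_const (.inl (hb.trans ht).ne')).mul
      (hasDerivAt_neg t).exp).congr_deriv ?_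
    rw [add_sub_cancel_right]
    ring
  have hlim : Tendsto (fun t : ℝ => t ^ a * Real.exp (-t)) atTop (𝓝 0) := by
    simpa using tendsto_rpow_mul_exp_neg_mul_atTop_nhds_zero a 1 one_pos
  have hparts := integral_Ioi_of_hasDerivAt_of_tendsto
    (continuousAt_rpow_mul_exp_neg a hb).continuousWithinAt hderiv (hint.sub hint') hlim
  rw [integral_sub hint hint', integral_const_mul] at hparts
  rw [lowerGamma, lowerGamma, Real.Gamma_add_one ha]
  linarith

lemma tendsto_lowerGamma_nhdsGT_zero {a : ℝ} (ha : 0 < a) :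
    Tendsto (lowerGamma a) (𝓝[>] 0) (𝓝 0) := by
  have hint : IntegrableOn (fun t : ℝ => t ^ (a - 1) * Real.exp (-t)) (Icc 0 1) := by
    rw [integrableOn_Icc_iff_integrableOn_Ioc]
    have hGamma := Real.GammaIntegral_convergent ha
    simp_rw [mul_comm (Real.exp _)] at hGamma
    exact hGamma.mono_set Ioc_subset_Ioi_self
  have hcont := intervalIntegral.continuousOn_primitive hint 0 (left_mem_Icc.2 zero_le_one)
  rw [ContinuousWithinAt, Ioc_self, setIntegral_empty] at hcont
  refine (hcont.mono_left (nhdsWithin_le_iff.2 (Icc_mem_nhdsGT one_pos))).congr' ?_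
  filter_upwards [self_mem_nhdsWithin] with b hb
  exact (lowerGamma_of_pos ha (le_of_lt hb)).symm

lemma tendsto_lowerGamma_sub_nhdsGT_zero {a : ℝ} (ha : -1 < a) (ha0 : a ≠ 0) :
    Tendsto (fun b => lowerGamma a b - b ^ a / a) (𝓝[>] 0) (𝓝 0) := by
  have hpow : Tendsto (fun b : ℝ => b ^ (a + 1)) (𝓝[>] 0) (𝓝 0) := by
    have hcont := (Real.continuousAt_rpow_const 0 (a + 1) (.inr (by linarith))).tendsto
    rw [Real.zero_rpow (by linarith)] at hcont
    exact hcont.mono_left nhdsWithin_le_nhds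
  have hexp : Tendsto (fun b : ℝ => b ^ a * (1 - Real.exp (-b))) (𝓝[>] 0) (𝓝 0) := by
    refine squeeze_zero' ?_ ?_ hpow <;> filter_upwards [self_mem_nhdsWithin] with b (hb : 0 < b)
    · exact mul_nonneg (by positivity) (sub_nonneg.2 (Real.exp_le_one_iff.2 (by linarith)))
    · rw [Real.rpow_add_one hb.ne']
      gcongr
      linarith [Real.add_one_le_exp (-b)]
  have hlim := ((tendsto_lowerGamma_nhdsGT_zero (a := a + 1) (by linarith)).sub hexp).div_const a
  rw [sub_zero, zero_div] at hlim
  refine hlim.congr' ?_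
  filter_upwards [self_mem_nhdsWithin] with b hb
  rw [lowerGamma_add_one ha0 hb]
  field_simp
  ring

end LowerGamma

section LogLaplace

/-- Logarithm of the conditional Laplace transform at `s` of the interference from beyond `z`, given
that `z` is an inverse power, when the inverse powers have intensity `powerMeasure c δ`. -/
noncomputable def logLaplace (c δ s z : ℝ) : ℝ :=
  c * z ^ δ + c * δ * s ^ δ * lowerGamma (-δ) (s / z)

variable {c δ s z : ℝ}

lemma tendsto_logLaplace_atTop (c : ℝ) (hδ : 0 < δ) (hδ1 : δ < 1) (hs : 0 < s) :
    Tendsto (logLaplace c δ s) atTop (𝓝 0) := by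
  have hdiv : Tendsto (fun z : ℝ => s / z) atTop (𝓝[>] 0) :=
    tendsto_nhdsWithin_iff.2 ⟨tendsto_id.const_div_atTop s,
      (eventually_gt_atTop 0).mono fun z hz => div_pos hs hz⟩
  have hlim := ((tendsto_lowerGamma_sub_nhdsGT_zero (a := -δ) (by linarith)
    (by linarith)).comp hdiv).const_mul (c * δ * s ^ δ)
  rw [mul_zero] at hlim
  refine hlim.congr' ?_
  filter_upwards [eventually_gt_atTop 0] with z hz
  rw [Function.comp_apply, logLaplace, Real.div_rpow hs.le hz.le, Real.rpow_neg hs.le,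
    Real.rpow_neg hz.le]
  field_simp
  ring

lemma hasDerivAt_logLaplace (c δ : ℝ) (hs : 0 < s) (hz : 0 < z) :
    HasDerivAt (logLaplace c δ s) (c * δ * z ^ (δ - 1) * (1 - Real.exp (-(s / z)))) z := by
  have hdiv : HasDerivAt (fun z : ℝ => s / z) (-s / z ^ 2) z :=
    ((hasDerivAt_const z s).fun_div (hasDerivAt_id' z) hz.ne').congr_deriv (by simp)
  refine (((Real.hasDerivAt_rpow_const (.inl hz.ne')).const_mul c).add
    (((hasDerivAt_lowerGamma (-δ) (div_pos hs hz)).comp z hdiv).const_mul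
      (c * δ * s ^ δ))).congr_deriv ?_
  rw [Real.div_rpow hs.le hz.le, Real.rpow_sub_one hs.ne', Real.rpow_sub_one hz.ne',
    Real.rpow_sub_one hz.ne', Real.rpow_neg hs.le, Real.rpow_neg hz.le]
  field_simp
  ring

lemma logLaplace_deriv_nonneg (hc : 0 ≤ c) (hδ : 0 < δ) (hs : 0 < s) (hz : 0 < z) :
    0 ≤ c * δ * z ^ (δ - 1) * (1 - Real.exp (-(s / z))) := by
  have hexp : Real.exp (-(s / z)) ≤ 1 := Real.exp_le_one_iff.2 (neg_nonpos.2 (by positivity))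
  exact mul_nonneg (by positivity) (sub_nonneg.2 hexp)

lemma logLaplace_nonpos (hc : 0 ≤ c) (hδ : 0 < δ) (hδ1 : δ < 1) (hs : 0 < s) (hz : 0 < z) :
    logLaplace c δ s z ≤ 0 := by
  have hmono : MonotoneOn (logLaplace c δ s) (Ioi 0) := by
    refine monotoneOn_of_hasDerivWithinAt_nonneg
      (f' := fun y => c * δ * y ^ (δ - 1) * (1 - Real.exp (-(s / y)))) (convex_Ioi 0)
      (fun y hy => (hasDerivAt_logLaplace c δ hs hy).continuousAt.continuousWithinAt)
      (fun y hy => ?_) fun y hy => ?_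
    · exact (hasDerivAt_logLaplace c δ hs (interior_subset hy)).hasDerivWithinAt
    · exact logLaplace_deriv_nonneg hc hδ hs (interior_subset hy)
  refine ge_of_tendsto (tendsto_logLaplace_atTop c hδ hδ1 hs) ?_
  filter_upwards [eventually_ge_atTop z] with y hy
  exact hmono hz (hz.trans_le hy) hy

lemma setLIntegral_powerMeasure_Ioi (hz : 0 ≤ z) {w : ℝ → ℝ≥0∞} (hw : Measurable w) :
    ∫⁻ y in Ioi z, w y ∂(powerMeasure c δ) =
      ∫⁻ y in Ioi z, ENNReal.ofReal (c * δ * y ^ (δ - 1)) * w y := by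
  rw [powerMeasure, restrict_withDensity measurableSet_Ioi,
    lintegral_withDensity_eq_lintegral_mul _ (by fun_prop) hw,
    Measure.restrict_restrict_of_subset (Ioi_subset_Ioi hz)]
  rfl

theorem tailExponent_powerMeasure (hc : 0 ≤ c) (hδ : 0 < δ) (hδ1 : δ < 1) (hs : 0 < s)
    (hz : 0 < z) :
    tailExponent (powerMeasure c δ) (fun y => ENNReal.ofReal (s / y)) z =
      ENNReal.ofReal (-logLaplace c δ s z) := by
  have hderiv (y : ℝ) (hy : y ∈ Ici z) := hasDerivAt_logLaplace c δ hs (hz.trans_le hy)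
  have hnonneg (y : ℝ) (hy : y ∈ Ioi z) := logLaplace_deriv_nonneg hc hδ hs (hz.trans hy)
  have hlim := tendsto_logLaplace_atTop c hδ hδ1 hs
  have hmeas : Measurable fun y : ℝ => 1 - expNeg (ENNReal.ofReal (s / y)) :=
    measurable_const.sub (measurable_expNeg.comp (by fun_prop))
  rw [tailExponent, setLIntegral_powerMeasure_Ioi hz.le hmeas, ← zero_sub,
    ← integral_Ioi_of_hasDerivAt_of_nonneg' hderiv hnonneg hlim,
    ofReal_integral_eq_lintegral_ofReal (integrableOn_Ioi_deriv_of_nonneg' hderiv hnonneg hlim)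
      ((ae_restrict_iff' measurableSet_Ioi).2 (.of_forall hnonneg))]
  refine setLIntegral_congr_fun measurableSet_Ioi fun y hy => ?_
  have hy0 : 0 < y := hz.trans hy
  rw [expNeg_ofReal (by positivity), ← ENNReal.ofReal_one,
    ← ENNReal.ofReal_sub _ (Real.exp_pos _).le, ← ENNReal.ofReal_mul (by positivity)]

lemma tailExponent_powerMeasure_ne_top (hc : 0 < c) (hδ : 0 < δ) (hδ1 : δ < 1) (hs : 0 < s)
    (hz : 0 ≤ z) :
    tailExponent (powerMeasure c δ) (fun y => ENNReal.ofReal (s / y)) z ≠ ∞ := by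
  refine ne_top_of_le_ne_top ?_ (antitone_tailExponent _ _ hz)
  rw [tailExponent, ← Ioc_union_Ioi_eq_Ioi zero_le_one,
    lintegral_union measurableSet_Ioi (Ioc_disjoint_Ioi le_rfl)]
  refine ENNReal.add_ne_top.2 ⟨ne_top_of_le_ne_top ?_ (setLIntegral_mono' measurableSet_Ioc
    fun y _ => (tsub_le_self : 1 - expNeg (ENNReal.ofReal (s / y)) ≤ 1)), ?_⟩
  · rw [setLIntegral_one]
    exact measure_ne_top_of_subset Ioc_subset_Iic_self
      ((isDiffuseIntensity_powerMeasure hc hδ).finite 1)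
  · exact (tailExponent_powerMeasure hc.le hδ hδ1 hs one_pos).trans_ne ENNReal.ofReal_ne_top

end LogLaplace

section Jensen

lemma toReal_expNeg {a : ℝ≥0∞} (ha : a ≠ ∞) : (expNeg a).toReal = Real.exp (-a.toReal) := by
  conv_lhs => rw [← ENNReal.ofReal_toReal ha, expNeg_ofReal ENNReal.toReal_nonneg]
  exact ENNReal.toReal_ofReal (Real.exp_pos _).le

lemma expNeg_lintegral_le {E : Type*} [MeasurableSpace E] {Q : Measure E} [IsProbabilityMeasure Q]
    {f : E → ℝ≥0∞} (hf : AEMeasurable f Q) :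
    expNeg (∫⁻ z, f z ∂Q) ≤ ∫⁻ z, expNeg (f z) ∂Q := by
  by_cases hf_int : ∫⁻ z, f z ∂Q = ∞
  · simp [hf_int, expNeg_top]
  have hfin : ∀ᵐ z ∂Q, f z ≠ ∞ := (ae_lt_top' hf hf_int).mono fun _ => LT.lt.ne
  have hexp : (fun z => (expNeg (f z)).toReal) =ᵐ[Q] fun z => Real.exp (-(f z).toReal) :=
    hfin.mono fun _ => toReal_expNeg
  have hexp_int : ∫⁻ z, expNeg (f z) ∂Q ≠ ∞ :=
    ne_top_of_le_ne_top (by simp) (lintegral_mono fun z => expNeg_le_one (f z))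
  have hmeas : AEMeasurable (fun z => expNeg (f z)) Q := measurable_expNeg.comp_aemeasurable hf
  rw [← ENNReal.toReal_le_toReal (expNeg_ne_top _) hexp_int, toReal_expNeg hf_int,
    ← integral_toReal hf (hfin.mono fun _ => Ne.lt_top), ← integral_neg,
    ← integral_toReal hmeas (.of_forall fun _ => (expNeg_ne_top _).lt_top), integral_congr_ae hexp]
  exact convexOn_exp.map_integral_le Real.continuous_exp.continuousOn isClosed_univ
    (.of_forall fun _ => mem_univ _) (integrable_toReal_of_lintegral_ne_top hf hf_int).neg
    ((integrable_congr hexp).1 (integrable_toReal_of_lintegral_ne_top hmeas hexp_int))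

end Jensen

section NthPointSeries

variable {Ω : Type*} [MeasurableSpace Ω] {P : Measure Ω} {η : Ω → Measure ℝ} {μ : Measure ℝ}

namespace IsPoissonRandomMeasure

lemma ae_nthPoint_of_ae (H : IsPoissonRandomMeasure P η μ) (hμ : IsDiffuseIntensity μ)
    {p : ℝ → Prop} (hp : ∀ᵐ z ∂μ, p z) (m : ℕ) : ∀ᵐ ω ∂P, p (nthPoint (η ω) (m + 1)) := by
  refine ae_of_ae_map (H.aemeasurable_nthPoint hμ m.succ_ne_zero) ?_
  rw [H.map_nthPoint hμ]
  exact (withDensity_absolutelyContinuous _ _).ae_le hp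

lemma ae_tsum_comp_nthPoint_ne_top (H : IsPoissonRandomMeasure P η μ) (hμ : IsDiffuseIntensity μ)
    {w : ℝ → ℝ≥0∞} (hw : Measurable w) (hw_top : ∀ z, w z ≠ ∞) {b : ℝ}
    (hb : ∫⁻ z in Ioi b, w z ∂μ ≠ ∞) (n : ℕ) :
    ∀ᵐ ω ∂P, ∑' k : ℕ, w (nthPoint (η ω) (n + 1 + k)) ≠ ∞ := by
  rw [← lintegral_indicator measurableSet_Ioi] at hb
  filter_upwards [H.ae_isPointConfiguration hμ,
    H.ae_lintegral_ne_top (hw.indicator measurableSet_Ioi) hb] with ω hω hfin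
  rw [lintegral_indicator measurableSet_Ioi] at hfin
  obtain ⟨m, hm⟩ := hω.integer (Iic b) measurableSet_Iic
  lift m to ℕ using fun hm_top => hω.finite b (by simp [hm, hm_top])
  rw [← hω.tsum_comp_nthPoint hm hw] at hfin
  have hall : ∑' k : ℕ, w (nthPoint (η ω) (k + 1)) ≠ ∞ := by
    rw [← Summable.sum_add_tsum_nat_add' (k := m) ENNReal.summable]
    refine ENNReal.add_ne_top.2 ⟨ENNReal.sum_ne_top.2 fun k _ => hw_top _, ?_⟩
    simpa only [Nat.add_comm, Nat.add_left_comm, add_assoc] using hfin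
  refine ne_top_of_le_ne_top hall (le_trans (le_of_eq (tsum_congr fun k => ?_))
    (ENNReal.tsum_comp_le_tsum_of_injective (add_right_injective n) _))
  rw [Nat.add_right_comm]

lemma aemeasurable_expNeg_tsum (H : IsPoissonRandomMeasure P η μ) (hμ : IsDiffuseIntensity μ)
    {w : ℝ → ℝ≥0∞} (hw : Measurable w) (n : ℕ) :
    AEMeasurable (fun ω => expNeg (∑' k : ℕ, w (nthPoint (η ω) (n + 1 + k)))) P :=
  measurable_expNeg.comp_aemeasurable (.tsum fun k =>
    hw.comp_aemeasurable (H.aemeasurable_nthPoint hμ (by omega)))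

end IsPoissonRandomMeasure

end NthPointSeries

section PowerIntensity

variable {c δ s : ℝ}

lemma ae_pos_nthPointLaw (c δ : ℝ) (m : ℕ) : ∀ᵐ z ∂(nthPointLaw (powerMeasure c δ) m), 0 < z :=
  (withDensity_absolutelyContinuous _ _).ae_le (ae_pos_powerMeasure c δ)

lemma logLaplace_ae_eq (hc : 0 ≤ c) (hδ : 0 < δ) (hδ1 : δ < 1) (hs : 0 < s) (m : ℕ) :
    (fun z => -(tailExponent (powerMeasure c δ) (fun y => ENNReal.ofReal (s / y)) z).toReal)
      =ᵐ[nthPointLaw (powerMeasure c δ) m] logLaplace c δ s := by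
  filter_upwards [ae_pos_nthPointLaw c δ m] with z hz
  rw [tailExponent_powerMeasure hc hδ hδ1 hs hz, ENNReal.toReal_ofReal
    (neg_nonneg.2 (logLaplace_nonpos hc hδ hδ1 hs hz)), neg_neg]

lemma ae_tailExponent_le (c δ : ℝ) (w : ℝ → ℝ≥0∞) (m : ℕ) :
    ∀ᵐ z ∂(nthPointLaw (powerMeasure c δ) m),
      tailExponent (powerMeasure c δ) w z ≤ tailExponent (powerMeasure c δ) w 0 :=
  (ae_pos_nthPointLaw c δ m).mono fun _ hz => antitone_tailExponent _ _ hz.le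

lemma integrable_logLaplace (hc : 0 < c) (hδ : 0 < δ) (hδ1 : δ < 1) (hs : 0 < s) (m : ℕ) :
    Integrable (logLaplace c δ s) (nthPointLaw (powerMeasure c δ) m) := by
  have := (isDiffuseIntensity_powerMeasure hc hδ).isProbabilityMeasure_nthPointLaw m
  refine (Integrable.of_bound (antitone_tailExponent (powerMeasure c δ)
    fun y => ENNReal.ofReal (s / y)).measurable.ennreal_toReal.neg.aestronglyMeasurable
    (tailExponent (powerMeasure c δ) (fun y => ENNReal.ofReal (s / y)) 0).toReal ?_).congr
    (logLaplace_ae_eq hc.le hδ hδ1 hs m)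
  filter_upwards [ae_tailExponent_le c δ (fun y => ENNReal.ofReal (s / y)) m] with z hz
  rw [Pi.neg_apply, norm_neg, Real.norm_of_nonneg ENNReal.toReal_nonneg]
  exact ENNReal.toReal_mono (tailExponent_powerMeasure_ne_top hc hδ hδ1 hs le_rfl) hz

lemma integral_logLaplace_eq_neg_toReal (hc : 0 < c) (hδ : 0 < δ) (hδ1 : δ < 1) (hs : 0 < s)
    (m : ℕ) :
    ∫ z, logLaplace c δ s z ∂(nthPointLaw (powerMeasure c δ) m) =
      -(∫⁻ z, tailExponent (powerMeasure c δ) (fun y => ENNReal.ofReal (s / y)) z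
        ∂(nthPointLaw (powerMeasure c δ) m)).toReal := by
  rw [← integral_congr_ae (logLaplace_ae_eq hc.le hδ hδ1 hs m), integral_neg, integral_toReal
    (antitone_tailExponent _ _).measurable.aemeasurable]
  filter_upwards [ae_tailExponent_le c δ (fun y => ENNReal.ofReal (s / y)) m] with z hz
  exact hz.trans_lt (tailExponent_powerMeasure_ne_top hc hδ hδ1 hs le_rfl).lt_top

lemma lintegral_tailExponent_ne_top (hc : 0 < c) (hδ : 0 < δ) (hδ1 : δ < 1) (hs : 0 < s) (m : ℕ) :
    ∫⁻ z, tailExponent (powerMeasure c δ) (fun y => ENNReal.ofReal (s / y)) z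
      ∂(nthPointLaw (powerMeasure c δ) m) ≠ ∞ := by
  have := (isDiffuseIntensity_powerMeasure hc hδ).isProbabilityMeasure_nthPointLaw m
  refine ne_top_of_le_ne_top ?_ (lintegral_mono_ae (ae_tailExponent_le c δ _ m))
  simpa using tailExponent_powerMeasure_ne_top hc hδ hδ1 hs le_rfl

lemma measureReal_powerMeasure_Iic_ae_eq (hc : 0 ≤ c) (hδ : 0 < δ) (m : ℕ) :
    (fun z => (powerMeasure c δ).real (Iic z)) =ᵐ[nthPointLaw (powerMeasure c δ) m]
      fun z => c * z ^ δ :=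
  (ae_pos_nthPointLaw c δ m).mono fun _ hz => measureReal_powerMeasure_Iic hc hδ hz.le

lemma integrable_mul_rpow_nthPointLaw (hc : 0 < c) (hδ : 0 < δ) (m : ℕ) :
    Integrable (fun z => c * z ^ δ) (nthPointLaw (powerMeasure c δ) m) :=
  ((isDiffuseIntensity_powerMeasure hc hδ).integrable_measureReal_Iic_nthPointLaw m).congr
    (measureReal_powerMeasure_Iic_ae_eq hc.le hδ m)

lemma integrable_lowerGamma_nthPointLaw (hc : 0 < c) (hδ : 0 < δ) (hδ1 : δ < 1) (hs : 0 < s)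
    (m : ℕ) :
    Integrable (fun z => lowerGamma (-δ) (s / z)) (nthPointLaw (powerMeasure c δ) m) := by
  have hfactor : c * δ * s ^ δ ≠ 0 := by positivity
  rw [← integrable_const_mul_iff hfactor.isUnit]
  refine ((integrable_logLaplace hc hδ hδ1 hs m).sub
    (integrable_mul_rpow_nthPointLaw hc hδ m)).congr (.of_forall fun z => ?_)
  exact add_sub_cancel_left _ _

lemma integral_logLaplace (hc : 0 < c) (hδ : 0 < δ) (hδ1 : δ < 1) (hs : 0 < s) (m : ℕ) :
    ∫ z, logLaplace c δ s z ∂(nthPointLaw (powerMeasure c δ) m) =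
      m + 1 + c * δ * s ^ δ *
        ∫ z, lowerGamma (-δ) (s / z) ∂(nthPointLaw (powerMeasure c δ) m) := by
  rw [← (isDiffuseIntensity_powerMeasure hc hδ).integral_measureReal_Iic_nthPointLaw m,
    integral_congr_ae (measureReal_powerMeasure_Iic_ae_eq hc.le hδ m), ← integral_const_mul,
    ← integral_add (integrable_mul_rpow_nthPointLaw hc hδ m)
      ((integrable_lowerGamma_nthPointLaw hc hδ hδ1 hs m).const_mul _)]
  rfl

lemma integral_nthPointLaw_powerMeasure (hc : 0 < c) (hδ : 0 < δ) (m : ℕ) (f : ℝ → ℝ) :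
    ∫ z, f z ∂(nthPointLaw (powerMeasure c δ) m) =
      ∫ z in Ioi 0, f z * (c * δ * z ^ (δ - 1) * poissonWeight (c * z ^ δ) m) := by
  have hmeas : Measurable fun z =>
      ENNReal.ofReal (poissonWeight ((powerMeasure c δ).real (Iic z)) m) :=
    (measurable_ofReal_poissonWeight m).comp
      (isDiffuseIntensity_powerMeasure hc hδ).measurable_measureReal_Iic
  rw [nthPointLaw, integral_withDensity_eq_integral_toReal_smul hmeas
    (.of_forall fun z => ENNReal.ofReal_lt_top), powerMeasure,
    integral_withDensity_eq_integral_toReal_smul (by fun_prop)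
    (.of_forall fun z => ENNReal.ofReal_lt_top)]
  refine setIntegral_congr_fun measurableSet_Ioi fun z (hz : 0 < z) => ?_
  rw [← powerMeasure, measureReal_powerMeasure_Iic hc.le hδ hz.le,
    ENNReal.toReal_ofReal (by positivity),
    ENNReal.toReal_ofReal (poissonWeight_nonneg (by positivity) m), smul_eq_mul, smul_eq_mul]
  ring

lemma setLIntegral_Ioi_div_powerMeasure_ne_top (hc : 0 ≤ c) (hδ : 0 ≤ δ) (hδ1 : δ < 1) (s : ℝ)
    {b : ℝ} (hb : 0 < b) :
    ∫⁻ z in Ioi b, ENNReal.ofReal (s / z) ∂(powerMeasure c δ) ≠ ∞ := by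
  rw [setLIntegral_powerMeasure_Ioi hb.le (by fun_prop)]
  have hint : IntegrableOn (fun z : ℝ => c * δ * s * z ^ (δ - 2)) (Ioi b) :=
    (integrableOn_Ioi_rpow_of_lt (by linarith) hb).const_mul _
  refine ne_top_of_le_ne_top hint.lintegral_lt_top.ne
    (setLIntegral_mono' measurableSet_Ioi fun z hz => le_of_eq ?_)
  have hz0 : 0 < z := hb.trans hz
  rw [← ENNReal.ofReal_mul (by positivity), show δ - 2 = δ - 1 - 1 by ring,
    Real.rpow_sub_one hz0.ne' (δ - 1)]
  ring_nf

end PowerIntensity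

section Interference

variable {Ω : Type*} [MeasurableSpace Ω] {P : Measure Ω} {η : Ω → Measure ℝ} {c δ s : ℝ}

namespace IsPoissonRandomMeasure

lemma ae_forall_nthPoint_pos (H : IsPoissonRandomMeasure P η (powerMeasure c δ)) (hc : 0 < c)
    (hδ : 0 < δ) (n : ℕ) : ∀ᵐ ω ∂P, ∀ k : ℕ, 0 < nthPoint (η ω) (n + 1 + k) := by
  refine ae_all_iff.2 fun k => ?_
  simpa only [Nat.add_right_comm] using H.ae_nthPoint_of_ae
    (isDiffuseIntensity_powerMeasure hc hδ) (ae_pos_powerMeasure c δ) (n + k)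

lemma ae_tsum_div_nthPoint_ne_top (H : IsPoissonRandomMeasure P η (powerMeasure c δ))
    (hc : 0 < c) (hδ : 0 < δ) (hδ1 : δ < 1) (s : ℝ) (n : ℕ) :
    ∀ᵐ ω ∂P, ∑' k : ℕ, ENNReal.ofReal (s / nthPoint (η ω) (n + 1 + k)) ≠ ∞ :=
  H.ae_tsum_comp_nthPoint_ne_top (isDiffuseIntensity_powerMeasure hc hδ)
    (w := fun z => ENNReal.ofReal (s / z)) (by fun_prop) (fun _ => ENNReal.ofReal_ne_top)
    (setLIntegral_Ioi_div_powerMeasure_ne_top hc.le hδ.le hδ1 s one_pos) n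

theorem ae_summable_inv_nthPoint (H : IsPoissonRandomMeasure P η (powerMeasure c δ))
    (hc : 0 < c) (hδ : 0 < δ) (hδ1 : δ < 1) (n : ℕ) :
    ∀ᵐ ω ∂P, Summable fun k : ℕ => (nthPoint (η ω) (n + 1 + k))⁻¹ := by
  filter_upwards [H.ae_tsum_div_nthPoint_ne_top hc hδ hδ1 1 n, H.ae_forall_nthPoint_pos hc hδ n]
    with ω hω hpos
  refine (ENNReal.summable_toReal hω).congr fun k => ?_
  rw [one_div, ENNReal.toReal_ofReal (inv_nonneg.2 (hpos k).le)]

lemma toReal_expNeg_tsum_ae_eq (H : IsPoissonRandomMeasure P η (powerMeasure c δ))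
    (hc : 0 < c) (hδ : 0 < δ) (hδ1 : δ < 1) (hs : 0 < s) (n : ℕ) :
    (fun ω => (expNeg (∑' k : ℕ, ENNReal.ofReal (s / nthPoint (η ω) (n + 1 + k)))).toReal)
      =ᵐ[P] fun ω => Real.exp (-s * ∑' k : ℕ, (nthPoint (η ω) (n + 1 + k))⁻¹) := by
  filter_upwards [H.ae_tsum_div_nthPoint_ne_top hc hδ hδ1 s n, H.ae_forall_nthPoint_pos hc hδ n]
    with ω hω hpos
  have hterm (k : ℕ) : (ENNReal.ofReal (s / nthPoint (η ω) (n + 1 + k))).toReal =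
      s * (nthPoint (η ω) (n + 1 + k))⁻¹ := by
    rw [ENNReal.toReal_ofReal (div_nonneg hs.le (hpos k).le), div_eq_mul_inv]
  rw [toReal_expNeg hω, ENNReal.tsum_toReal_eq fun _ => ENNReal.ofReal_ne_top]
  simp_rw [hterm]
  rw [tsum_mul_left, neg_mul]

theorem integrable_exp_tsum_inv_nthPoint (H : IsPoissonRandomMeasure P η (powerMeasure c δ))
    (hc : 0 < c) (hδ : 0 < δ) (hδ1 : δ < 1) (hs : 0 < s) (n : ℕ) :
    Integrable (fun ω => Real.exp (-s * ∑' k : ℕ, (nthPoint (η ω) (n + 1 + k))⁻¹)) P := by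
  have := H.isProbabilityMeasure
  refine (integrable_toReal_of_lintegral_ne_top (H.aemeasurable_expNeg_tsum
    (isDiffuseIntensity_powerMeasure hc hδ) (w := fun z => ENNReal.ofReal (s / z)) (by fun_prop) n)
    (ne_top_of_le_ne_top ?_ (lintegral_mono fun ω => expNeg_le_one _))).congr
    (H.toReal_expNeg_tsum_ae_eq hc hδ hδ1 hs n)
  simp

theorem exp_integral_logLaplace_le (H : IsPoissonRandomMeasure P η (powerMeasure c δ))
    (hc : 0 < c) (hδ : 0 < δ) (hδ1 : δ < 1) (hs : 0 < s) (m : ℕ) :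
    Real.exp (∫ z, logLaplace c δ s z ∂(nthPointLaw (powerMeasure c δ) m)) ≤
      ∫ ω, Real.exp (-s * ∑' k : ℕ, (nthPoint (η ω) (m + 1 + 1 + k))⁻¹) ∂P := by
  have hμ := isDiffuseIntensity_powerMeasure hc hδ
  have := H.isProbabilityMeasure
  have := hμ.isProbabilityMeasure_nthPointLaw m
  set w : ℝ → ℝ≥0∞ := fun z => ENNReal.ofReal (s / z)
  have hw : Measurable w := by fun_prop
  rw [integral_logLaplace_eq_neg_toReal hc hδ hδ1 hs,
    ← toReal_expNeg (lintegral_tailExponent_ne_top hc hδ hδ1 hs m),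
    ← integral_congr_ae (H.toReal_expNeg_tsum_ae_eq hc hδ hδ1 hs (m + 1)),
    integral_toReal (H.aemeasurable_expNeg_tsum hμ hw (m + 1))
      (.of_forall fun _ => (expNeg_ne_top _).lt_top)]
  refine ENNReal.toReal_mono (ne_top_of_le_ne_top (by simp)
    (lintegral_mono fun _ => expNeg_le_one _)) ?_
  exact (expNeg_lintegral_le (antitone_tailExponent _ _).measurable.aemeasurable).trans
    (H.lintegral_expNeg_tailExponent_le hμ hw m)

lemma integrable_lowerGamma_nthPoint (H : IsPoissonRandomMeasure P η (powerMeasure c δ))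
    (hc : 0 < c) (hδ : 0 < δ) (hδ1 : δ < 1) (hs : 0 < s) (m : ℕ) :
    Integrable (fun ω => lowerGamma (-δ) (s / nthPoint (η ω) (m + 1))) P := by
  have hμ := isDiffuseIntensity_powerMeasure hc hδ
  have hint := integrable_lowerGamma_nthPointLaw hc hδ hδ1 hs m
  rw [← H.map_nthPoint hμ] at hint
  exact hint.comp_aemeasurable (H.aemeasurable_nthPoint hμ m.succ_ne_zero)

lemma integral_lowerGamma_nthPoint (H : IsPoissonRandomMeasure P η (powerMeasure c δ))
    (hc : 0 < c) (hδ : 0 < δ) (hδ1 : δ < 1) (hs : 0 < s) (m : ℕ) :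
    ∫ ω, lowerGamma (-δ) (s / nthPoint (η ω) (m + 1)) ∂P =
      ∫ z, lowerGamma (-δ) (s / z) ∂(nthPointLaw (powerMeasure c δ) m) := by
  have hμ := isDiffuseIntensity_powerMeasure hc hδ
  have hint := integrable_lowerGamma_nthPointLaw hc hδ hδ1 hs m
  rw [← H.map_nthPoint hμ] at hint ⊢
  exact (integral_map (H.aemeasurable_nthPoint hμ m.succ_ne_zero) hint.aestronglyMeasurable).symm

end IsPoissonRandomMeasure

end Interference

lemma nthInvPower_eq_nthPoint {Ω : Type*} (α φ : ℝ) (x : Plane) (X : ℕ → Ω → Plane)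
    (h : ℕ → Ω → ℝ) (n : ℕ) (ω : Ω) :
    nthInvPower α φ x X h n ω = nthPoint (invPowerMeasure α φ x X h ω) n := by
  rw [nthInvPower, nthPoint]
  congr 1
  ext t
  simp only [mem_ofPred_eq]
  rw [invPowerMeasure_apply _ _ _ _ _ _ measurableSet_Iic, ← ENat.toENNReal_coe,
    ENat.toENNReal_le]
  rfl

lemma gainMoment_pos {α : ℝ} {ν : Measure ℝ} [NeZero ν] (hν_pos : ∀ᵐ t ∂ν, 0 < t)
    (hν_int : Integrable (fun t : ℝ => t ^ (2 / α)) ν) : 0 < gainMoment α ν := by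
  have hpos : ∀ᵐ t ∂ν, 0 < t ^ (2 / α) := hν_pos.mono fun t ht => Real.rpow_pos_of_pos ht _
  have hsupport : (Function.support fun t : ℝ => t ^ (2 / α)) =ᵐ[ν] univ :=
    eventuallyEq_univ.2 (hpos.mono fun _ => ne_of_gt)
  rw [gainMoment, integral_pos_iff_support_of_nonneg_ae (hpos.mono fun _ => le_of_lt) hν_int,
    measure_congr hsupport, Measure.measure_univ_pos]
  exact NeZero.ne ν

lemma invPowerPDF_eq_poissonWeight {lam α φ : ℝ} {ν : Measure ℝ} (m : ℕ) {z : ℝ} (hz : 0 < z) :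
    invPowerPDF lam α φ ν (m + 1) z =
      1 / 2 * gainMoment α ν * φ * lam * (2 / α) * z ^ (2 / α - 1) *
        poissonWeight (1 / 2 * gainMoment α ν * φ * lam * z ^ (2 / α)) m := by
  rw [invPowerPDF, poissonWeight, Real.rpow_sub_one hz.ne', Nat.add_sub_cancel, pow_succ]
  field_simp

theorem mainTheorem7 {Ω : Type*} [MeasurableSpace Ω] (P : Measure Ω) [IsProbabilityMeasure P]
    (lam α φ : ℝ) (hlam : 0 < lam) (hα : 2 < α) (hφ0 : 0 < φ) (hφ : φ ≤ 2 * Real.pi)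
    (ν : Measure ℝ) (hν_pos : ∀ᵐ t ∂ν, 0 < t)
    (hν_int : Integrable (fun t : ℝ => t ^ (2 / α)) ν)
    (X : ℕ → Ω → Plane) (h : ℕ → Ω → ℝ) (hnet : IsPoissonNetwork P lam ν X h)
    (x : Plane) (n : ℕ) (hn : 1 ≤ n) (s : ℝ) (hs : 0 < s) :
    -- the series defining the partial accumulative interference converges almost surely
    (∀ᵐ ω ∂P, Summable fun k : ℕ => (nthInvPower α φ x X h (n + 1 + k) ω)⁻¹) ∧
    -- the Laplace transform is the expectation of an integrable variable
    Integrable (fun ω => Real.exp (-s * partialInterference α φ x X h n ω)) P ∧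
    -- the expectation in the bound exists, and is the integral against the density
    Integrable (fun ω => lowerGamma (-2 / α) (s / nthInvPower α φ x X h n ω)) P ∧
    (∫ ω, lowerGamma (-2 / α) (s / nthInvPower α φ x X h n ω) ∂P =
      ∫ z in Ioi (0 : ℝ), lowerGamma (-2 / α) (s / z) * invPowerPDF lam α φ ν n z) ∧
    -- the lower bound
    Real.exp (n + φ * lam * gainMoment α ν * s ^ (2 / α) / α *
        ∫ ω, lowerGamma (-2 / α) (s / nthInvPower α φ x X h n ω) ∂P) ≤
      ∫ ω, Real.exp (-s * partialInterference α φ x X h n ω) ∂P := by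
  obtain ⟨m, rfl⟩ := Nat.exists_eq_add_of_le' hn
  have hα0 : 0 < α := two_pos.trans hα
  have hδ : 0 < 2 / α := by positivity
  have hδ1 : 2 / α < 1 := (div_lt_one hα0).2 hα
  have := (hnet.gain_law 0).isProbabilityMeasure_iff.1 inferInstance
  have hmoment := gainMoment_pos hν_pos hν_int
  have hc : 0 < 1 / 2 * gainMoment α ν * φ * lam := by positivity
  have H := hnet.isPoissonRandomMeasure_invPowerMeasure α φ x
  rw [map_markInvPower_restrict_visible hlam.le hα0 hφ0.le hφ hν_pos hν_int] at H
  simp only [partialInterference, nthInvPower_eq_nthPoint, neg_div,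
    H.integral_lowerGamma_nthPoint hc hδ hδ1 hs]
  refine ⟨H.ae_summable_inv_nthPoint hc hδ hδ1 (m + 1),
    H.integrable_exp_tsum_inv_nthPoint hc hδ hδ1 hs (m + 1),
    H.integrable_lowerGamma_nthPoint hc hδ hδ1 hs m, ?_, ?_⟩
  · rw [integral_nthPointLaw_powerMeasure hc hδ]
    exact setIntegral_congr_fun measurableSet_Ioi fun z hz => by
      rw [invPowerPDF_eq_poissonWeight m hz]
  · convert! H.exp_integral_logLaplace_le hc hδ hδ1 hs m using 2
    rw [integral_logLaplace hc hδ hδ1 hs]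
    push_cast
    ring
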